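/- Let $m\ge 1$, let $\Omega\subset\mathbb R^m$ be a bounded domain, and let $A\subset\Gamma\subset\Omega$, where $\Gamma$ is relatively closed in $\Omega$, $\Gamma\setminus A$ is an (embedded) $C^1$ hypersurface, i.e. a $C^1$ submanifold of dimension $m-1$, and $\mathcal H^{m-1}(\overline A)=0$. Let $\vec F\in C^1(\Omega\setminus\Gamma;\mathbb R^m)$ and $H\in C^0(\Omega\setminus\Gamma)\cap L^1_{loc}(\Omega)$. Let $u\in W^1(\Omega)\cap C^1(\Omega\setminus\Gamma)$, where $W^1(\Omega)$ is the space of locally integrable functions with locally integrable weak gradient, and suppose that $\nabla u+\vec F\neq 0$ at every point of $\Omega\setminus\Gamma$. Put $N(u)=\frac{\nabla u+\vec F}{|\nabla u+\vec F|}$ and $S(u)=\{x\in\Omega:\nabla u+\vec F=0\}$. One says that $u\in W^1(\Omega)$ is a weak solution of $\operatorname{div}N(u)=H$ in $\Omega$ if for all $\varphi\in C_0^\infty(\Omega)$ $$\int_{S(u)}|\nabla\varphi|+\int_{\Omega\setminus S(u)}N(u)\cdot\nabla\varphi+\int_\Omega H\varphi\ \ge 0 .$$ Let $\{\Omega_j\}$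 be the (at most countably many) connected components of $\Omega\setminus\Gamma$, and let $N_j(u)$ be the restriction of $N(u)$ to $\Omega_j$. Suppose that for each $j$, $N_j(u)\in C^1(\Omega_j)$, $\operatorname{div}N_j(u)=H$ in $\Omega_j$, and $N_j(u)$ extends continuously to $\partial\Omega_j\cap(\Gamma\setminus A)$; here $\Omega\setminus\Gamma$ is regarded as cut apart along $\Gamma$, so that a component lying on both sides of $\Gamma\setminus A$ is only required to have a continuous extension from each side separately. Then $u$ is a weak solution of $\operatorname{div}N(u)=H$ in $\Omega$ if and only if at every $p\in\Gamma\setminus A$ $$(N_j(u)-N_l(u))\cdot\nu_j=(N_j(u)-N_l(u))\cdot\nu_l=0 ,$$ where $\Omega_j$ and $\Omega_l$ (possibly $l=j$) are the components adjacent to $\Gamma\setminus A$ at $p$ on its two sides, $\nu_j$ and $\nu_l=-\nu_j$ are the corresponding outward unit normals at $p$, and $N_j(u)$, $N_l(u)$ are evaluated at $p$ as the limits from the respective sides. -/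

import Mathlib

open MeasureTheory Set Filter Topology

open scoped ContDiff InnerProductSpace Gradient

noncomputable section

/-- Test functions on `Ω`: smooth functions with compact support contained in `Ω`. -/
structure IsTestFunction {m : ℕ} (Ω : Set (EuclideanSpace ℝ (Fin m)))
    (φ : EuclideanSpace ℝ (Fin m) → ℝ) : Prop where
  smooth : ContDiff ℝ ∞ φ
  compact : HasCompactSupport φ
  supp : tsupport φ ⊆ Ω

/-- `G` is the weak gradient of `u` in the open set `Ω`: it is locally integrable and
`∫ u ∂ᵢφ = - ∫ Gᵢ φ` for every test function `φ` and every `i`. -/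
structure IsWeakGradient {m : ℕ} (Ω : Set (EuclideanSpace ℝ (Fin m)))
    (u : EuclideanSpace ℝ (Fin m) → ℝ)
    (G : EuclideanSpace ℝ (Fin m) → EuclideanSpace ℝ (Fin m)) : Prop where
  locInt : LocallyIntegrableOn G Ω volume
  byParts : ∀ φ : EuclideanSpace ℝ (Fin m) → ℝ, IsTestFunction Ω φ → ∀ i : Fin m,
    ∫ x in Ω, u x * (∇ φ x) i = - ∫ x in Ω, G x i * φ x

/-- The space `W¹(Ω)` of weakly differentiable functions: `u` and its weak gradient are
locally integrable in `Ω`. -/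
def MemW1 {m : ℕ} (Ω : Set (EuclideanSpace ℝ (Fin m)))
    (u : EuclideanSpace ℝ (Fin m) → ℝ) : Prop :=
  LocallyIntegrableOn u Ω volume ∧ ∃ G, IsWeakGradient Ω u G

/-- The direction `v / |v|` of a vector (used only for `v ≠ 0`). -/
def unitDir {m : ℕ} (v : EuclideanSpace ℝ (Fin m)) : EuclideanSpace ℝ (Fin m) :=
  ‖v‖⁻¹ • v

/-- Weak solutions of `div ((∇u + F) / |∇u + F|) = H` in `Ω`: functions `u ∈ W¹(Ω)` such that,
with `G` the weak gradient of `u` (unique up to null sets) and `S(u) = {x ∈ Ω | G + F = 0}`,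
`∫_{S(u)} |∇φ| + ∫_{Ω \ S(u)} N(u) · ∇φ + ∫_Ω H φ ≥ 0` for all test functions `φ`. -/
def IsWeakSolution {m : ℕ} (Ω : Set (EuclideanSpace ℝ (Fin m)))
    (F : EuclideanSpace ℝ (Fin m) → EuclideanSpace ℝ (Fin m))
    (H u : EuclideanSpace ℝ (Fin m) → ℝ) : Prop :=
  LocallyIntegrableOn u Ω volume ∧ ∃ G, IsWeakGradient Ω u G ∧
    ∀ φ : EuclideanSpace ℝ (Fin m) → ℝ, IsTestFunction Ω φ →
      0 ≤ (∫ x in {x ∈ Ω | G x + F x = 0}, ‖∇ φ x‖)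
        + (∫ x in {x ∈ Ω | G x + F x ≠ 0}, ⟪unitDir (G x + F x), ∇ φ x⟫_ℝ)
        + ∫ x in Ω, H x * φ x

/-- The field `N(u) = (∇u + F) / |∇u + F|`, with the classical gradient of `u`. -/
def normalField {m : ℕ} (F : EuclideanSpace ℝ (Fin m) → EuclideanSpace ℝ (Fin m))
    (u : EuclideanSpace ℝ (Fin m) → ℝ) (x : EuclideanSpace ℝ (Fin m)) :
    EuclideanSpace ℝ (Fin m) :=
  unitDir (∇ u x + F x)

/-- The divergence `∑ᵢ ∂ᵢ Xᵢ` of a vector field. -/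
def divergence {m : ℕ} (X : EuclideanSpace ℝ (Fin m) → EuclideanSpace ℝ (Fin m))
    (x : EuclideanSpace ℝ (Fin m)) : ℝ :=
  ∑ i : Fin m, (fderiv ℝ X x (EuclideanSpace.single i 1)) i

/-- `ρ` is a `C¹` defining function of `M` in the open set `V`: it has no critical points in `V`
and `M ∩ V` is its zero set. -/
structure IsDefiningFunction {m : ℕ} (M V : Set (EuclideanSpace ℝ (Fin m)))
    (ρ : EuclideanSpace ℝ (Fin m) → ℝ) : Prop where
  isOpen : IsOpen V
  contDiffOn : ContDiffOn ℝ 1 ρ V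
  grad_ne_zero : ∀ x ∈ V, ∇ ρ x ≠ 0
  inter_eq : M ∩ V = {x ∈ V | ρ x = 0}

/-- `M` is an (embedded) `C¹` hypersurface, that is, a `C¹` submanifold of dimension `m - 1`. -/
def IsC1Hypersurface {m : ℕ} (M : Set (EuclideanSpace ℝ (Fin m))) : Prop :=
  ∀ p ∈ M, ∃ V ρ, p ∈ V ∧ IsDefiningFunction M V ρ

/-- `D` is a connected component of `G`. -/
def IsComponentOf {m : ℕ} (G D : Set (EuclideanSpace ℝ (Fin m))) : Prop :=
  ∃ x ∈ G, D = connectedComponentIn G x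

/-- At the point `p` of the hypersurface `Γ \ A`, the piece `D` of the complement of `Γ` lies on
one side of `Γ \ A`, and `ν` is the unit normal to `Γ \ A` at `p` pointing out of `D` there: near
`p` the set `D` contains the side `{ρ < 0}` (without `Γ`) of the hypersurface `{ρ = 0}`, and
`ν = ∇ρ(p) / |∇ρ(p)|`. The set `D` may also lie on the other side of `Γ \ A`; then both normals
are outward normals of `D` at `p`, one for each side. -/
def IsOutwardNormal {m : ℕ} (Γ A D : Set (EuclideanSpace ℝ (Fin m)))
    (p ν : EuclideanSpace ℝ (Fin m)) : Prop :=
  ∃ V ρ, p ∈ V ∧ IsDefiningFunction (Γ \ A) V ρ ∧ {x ∈ V | ρ x < 0} \ Γ ⊆ D ∧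
    ν = unitDir (∇ ρ p)

/-- The restriction of the field `N` to `D` has the limit `n` at the point `p` of the hypersurface
`M`, from that side of `M` whose outward unit normal at `p` is `ν`. A continuous extension of
`N` from `D` to the copy of `M` that bounds this side exists if and only if such a limit exists
at each point, and the limits are then its values. -/
def HasSideLimit {m : ℕ} (M D : Set (EuclideanSpace ℝ (Fin m)))
    (N : EuclideanSpace ℝ (Fin m) → EuclideanSpace ℝ (Fin m))
    (p ν n : EuclideanSpace ℝ (Fin m)) : Prop :=
  ∃ V ρ, p ∈ V ∧ IsDefiningFunction M V ρ ∧ ν = unitDir (∇ ρ p) ∧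
    Tendsto N (𝓝[{x ∈ V | ρ x < 0} ∩ D] p) (𝓝 n)

end

/-! ### Calculus rules for the gradient. -/

section Gradient

variable {E : Type*} [NormedAddCommGroup E] [InnerProductSpace ℝ E] [CompleteSpace E]

/-! The set `Γ` is null and carries all possible singular points, so the term over `S(u)` vanishes.
Testing with `φ` and `-φ` turns the inequality into an equality: `u` is a weak solution iff `N(u)`
has distributional divergence `H` in `Ω` (`isWeakSolution_iff_forall_integral_eq_zero`). Off `Γ`
this holds classically, so the question is whether `div N` has a singular part on `Γ`.

The closure of `A` carries none: `N` is bounded, and a closed set with zero `(m-1)`-dimensional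
Hausdorff measure has cutoffs whose gradients are arbitrarily small in `L¹`
(`HasWeakDivergence.of_diff`). On `Γ \ A` the singular part is the jump of the normal component. It
is measured without surface integrals, through defining functions `ρ`. Multiplying a test function
by a steep transition in `ρ` gives the boundary term on `{ρ > 0}` a sign as soon as `⟪X, ∇ρ⟫` has
one (`HasWeakDivergence.setIntegral_nonpos`). Comparing `X` on both sides with a `C¹` field `k • e`
transverse to the hypersurface yields a bound proportional to a parameter `δ`
(`HasWeakDivergence.integral_le_of_normal_bounds`). If the one-sided normal limits agree, every `δ >
0` is admissible and the divergence has no singular part (`HasWeakDivergence.of_normal_limits`). If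
they differ, a negative `δ` is admissible for `X` or `-X`, and some test function violates the
equation (`HasWeakDivergence.normal_limit_eq`).

It remains to see that each side of `Γ \ A` at `p` belongs to one component. Points of `A` may
accumulate at `p`, so this needs that a closed `H^{m-1}`-null set does not disconnect a connected
open set, which again follows from removability. Finally, normals and sides do not depend on the
defining function (`IsDefiningFunction.unitDir_gradient_eq_or_eq_neg`, `eventually_neg_iff_neg`). -/

theorem gradient_eq_toDual_symm (f : E → ℝ) (x : E) :
    ∇ f x = (InnerProductSpace.toDual ℝ E).symm (fderiv ℝ f x) := rfl

theorem inner_gradient_eq (f : E → ℝ) (x v : E) : ⟪∇ f x, v⟫_ℝ = fderiv ℝ f x v := by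
  simp [gradient_eq_toDual_symm]

theorem ContDiff.continuous_gradient {f : E → ℝ} (hf : ContDiff ℝ 1 f) : Continuous (∇ f) :=
  (InnerProductSpace.toDual ℝ E).symm.continuous.comp (hf.continuous_fderiv one_ne_zero)

theorem ContDiffOn.continuousOn_gradient {f : E → ℝ} {V : Set E} (hf : ContDiffOn ℝ 1 f V)
    (hV : IsOpen V) : ContinuousOn (∇ f) V :=
  (InnerProductSpace.toDual ℝ E).symm.continuous.comp_continuousOn
    (hf.continuousOn_fderiv_of_isOpen hV le_rfl)

theorem gradient_mul_apply {f g : E → ℝ} {x : E} (hf : DifferentiableAt ℝ f x)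
    (hg : DifferentiableAt ℝ g x) :
    ∇ (fun y => f y * g y) x = f x • ∇ g x + g x • ∇ f x := by
  simp only [gradient_eq_toDual_symm]
  rw [fderiv_fun_mul hf hg]
  simp

theorem gradient_add_apply {f g : E → ℝ} {x : E} (hf : DifferentiableAt ℝ f x)
    (hg : DifferentiableAt ℝ g x) :
    ∇ (fun y => f y + g y) x = ∇ f x + ∇ g x := by
  simp only [gradient_eq_toDual_symm]
  rw [fderiv_fun_add hf hg]
  simp

theorem gradient_neg_apply (f : E → ℝ) (x : E) : ∇ (fun y => - f y) x = - ∇ f x := by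
  simp only [gradient_eq_toDual_symm]
  rw [fderiv_fun_neg]
  simp

theorem gradient_one_sub_apply (f : E → ℝ) (x : E) : ∇ (fun y => 1 - f y) x = - ∇ f x := by
  simp only [gradient_eq_toDual_symm]
  rw [fderiv_const_sub]
  simp

theorem gradient_comp_apply {τ : ℝ → ℝ} {f : E → ℝ} {x : E} (hτ : DifferentiableAt ℝ τ (f x))
    (hf : DifferentiableAt ℝ f x) :
    ∇ (fun y => τ (f y)) x = deriv τ (f x) • ∇ f x := by
  have h : HasFDerivAt (fun y => τ (f y)) (deriv τ (f x) • fderiv ℝ f x) x :=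
    hτ.hasDerivAt.comp_hasFDerivAt x hf.hasFDerivAt
  simp only [gradient_eq_toDual_symm]
  rw [h.fderiv]
  simp

theorem gradient_comp_add_right_apply (f : E → ℝ) (a x : E) :
    ∇ (fun y => f (y + a)) x = ∇ f (x + a) := by
  simp only [gradient_eq_toDual_symm]
  rw [fderiv_comp_add_right]

theorem gradient_eq_zero_of_notMem_tsupport {f : E → ℝ} {x : E} (hx : x ∉ tsupport f) :
    ∇ f x = 0 := by
  have h : f =ᶠ[𝓝 x] fun _ => 0 := notMem_tsupport_iff_eventuallyEq.1 hx
  rw [h.gradient_eq, gradient_fun_const]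

end Gradient

/-! ### Weak divergence tested with compactly supported `C¹` functions. -/

section WeakDivergence

variable {E : Type*} [NormedAddCommGroup E] [InnerProductSpace ℝ E]

/-- `C¹` functions with compact support contained in `W`. -/
structure IsC1Test (W : Set E) (φ : E → ℝ) : Prop where
  contDiff : ContDiff ℝ 1 φ
  compact : HasCompactSupport φ
  supp : tsupport φ ⊆ W

namespace IsC1Test

variable {W W' : Set E} {φ ψ : E → ℝ}

theorem mono (h : IsC1Test W φ) (hW : W ⊆ W') : IsC1Test W' φ :=
  ⟨h.contDiff, h.compact, h.supp.trans hW⟩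

theorem neg (h : IsC1Test W φ) : IsC1Test W (fun x => - φ x) :=
  ⟨h.contDiff.neg, h.compact.neg, (by simpa [tsupport, Function.support_neg] using h.supp)⟩

theorem add (h : IsC1Test W φ) (h' : IsC1Test W ψ) : IsC1Test W (fun x => φ x + ψ x) :=
  ⟨h.contDiff.add h'.contDiff, h.compact.add h'.compact,
    (tsupport_add φ ψ).trans (union_subset h.supp h'.supp)⟩

theorem mul_left (h : IsC1Test W φ) (hψ : ContDiff ℝ 1 ψ) : IsC1Test W (fun x => ψ x * φ x) :=
  ⟨hψ.mul h.contDiff, h.compact.mul_left, (tsupport_mul_subset_right).trans h.supp⟩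

theorem mul_left_of_contDiffOn (h : IsC1Test W φ) (hW : IsOpen W) (hψ : ContDiffOn ℝ 1 ψ W) :
    IsC1Test W (fun x => ψ x * φ x) := by
  refine ⟨contDiff_iff_contDiffAt.2 fun x => ?_, h.compact.mul_left,
    tsupport_mul_subset_right.trans h.supp⟩
  by_cases hx : x ∈ tsupport φ
  · exact (hψ.contDiffAt (hW.mem_nhds (h.supp hx))).mul h.contDiff.contDiffAt
  · refine (contDiffAt_const (c := (0 : ℝ))).congr_of_eventuallyEq ?_
    filter_upwards [notMem_tsupport_iff_eventuallyEq.1 hx] with y hy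
    simp [hy]

theorem differentiableAt (h : IsC1Test W φ) (x : E) : DifferentiableAt ℝ φ x :=
  (h.contDiff.differentiable one_ne_zero) x

theorem eq_zero (h : IsC1Test W φ) {x : E} (hx : x ∉ W) : φ x = 0 :=
  image_eq_zero_of_notMem_tsupport fun hx' => hx (h.supp hx')

theorem gradient_eq_zero [CompleteSpace E] (h : IsC1Test W φ) {x : E} (hx : x ∉ W) : ∇ φ x = 0 :=
  gradient_eq_zero_of_notMem_tsupport fun hx' => hx (h.supp hx')

end IsC1Test

theorem inner_gradient_mul [CompleteSpace E] {k φ : E → ℝ} {W : Set E} (hW : IsOpen W)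
    (hk : ContDiffOn ℝ 1 k W) (hφ : IsC1Test W φ) (e : E) (x : E) :
    ⟪∇ (fun y => k y * φ y) x, e⟫_ℝ = ⟪k x • e, ∇ φ x⟫_ℝ + ⟪∇ k x, e⟫_ℝ * φ x := by
  by_cases hx : x ∈ W
  · rw [gradient_mul_apply ((hk.differentiableOn one_ne_zero).differentiableAt (hW.mem_nhds hx))
      (hφ.differentiableAt x), inner_add_left, real_inner_smul_left, real_inner_smul_left,
      real_inner_smul_left, real_inner_comm]
    ring
  · rw [(hφ.mul_left_of_contDiffOn hW hk).gradient_eq_zero hx, hφ.gradient_eq_zero hx,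
      hφ.eq_zero hx]
    simp

variable [FiniteDimensional ℝ E] [MeasurableSpace E] [BorelSpace E]

/-- `div X = h` in `W`, tested with `C¹` functions. -/
def HasWeakDivergence (W : Set E) (X : E → E) (h : E → ℝ) : Prop :=
  ∀ φ : E → ℝ, IsC1Test W φ → ∫ x, (⟪X x, ∇ φ x⟫_ℝ + h x * φ x) = 0

theorem IntegrableOn.inner_continuous {X Y : E → E} {K : Set E} (hK : IsCompact K)
    (hX : IntegrableOn X K volume) (hY : Continuous Y) :
    IntegrableOn (fun x => ⟪X x, Y x⟫_ℝ) K volume := by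
  obtain ⟨C, hC⟩ := hK.exists_bound_of_continuousOn hY.continuousOn
  refine Integrable.mono' (hX.norm.mul_const C)
    (hX.aestronglyMeasurable.inner hY.aestronglyMeasurable) ?_
  filter_upwards [ae_restrict_mem hK.measurableSet] with x hx
  exact (norm_inner_le_norm _ _).trans (mul_le_mul_of_nonneg_left (hC x hx) (norm_nonneg _))

theorem IsC1Test.integrable {W : Set E} {φ : E → ℝ} (hφ : IsC1Test W φ) {X : E → E} {h : E → ℝ}
    (hX : LocallyIntegrableOn X W volume) (hh : LocallyIntegrableOn h W volume) :
    Integrable (fun x => ⟪X x, ∇ φ x⟫_ℝ + h x * φ x) volume := by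
  have hK : IsCompact (tsupport φ) := hφ.compact
  have h1 := IntegrableOn.inner_continuous hK (hX.integrableOn_compact_subset hφ.supp hK)
    hφ.contDiff.continuous_gradient
  have h2 : IntegrableOn (fun x => h x * φ x) (tsupport φ) volume :=
    (hh.integrableOn_compact_subset hφ.supp hK).mul_continuousOn hφ.contDiff.continuous.continuousOn
      hK
  refine (integrableOn_iff_integrable_of_support_subset ?_).1 (h1.add h2)
  intro x hx
  by_contra hx'
  apply hx
  simp [gradient_eq_zero_of_notMem_tsupport hx', image_eq_zero_of_notMem_tsupport hx']

theorem integrable_inner_gradient {w : E → ℝ} (hw : ContDiff ℝ 1 w) (hc : HasCompactSupport w)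
    (e : E) : Integrable (fun x => ⟪∇ w x, e⟫_ℝ) volume := by
  have h : IsC1Test univ w := ⟨hw, hc, subset_univ _⟩
  have := h.integrable (X := fun _ => e) (h := fun _ => 0)
    (continuous_const.locallyIntegrable.locallyIntegrableOn _)
    (continuous_const.locallyIntegrable.locallyIntegrableOn _)
  simpa [real_inner_comm] using this

theorem integral_inner_gradient_eq_zero {w : E → ℝ} (hw : ContDiff ℝ 1 w)
    (hc : HasCompactSupport w) (e : E) : ∫ x, ⟪∇ w x, e⟫_ℝ = 0 := by
  -- Integration by parts against the constant function `1`.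
  have key := integral_mul_fderiv_eq_neg_fderiv_mul_of_integrable (𝕜 := ℝ) (μ := (volume : Measure E))
    (f := fun _ => (1 : ℝ)) (g := w) (v := e) (by simp)
    (by simpa [inner_gradient_eq] using integrable_inner_gradient hw hc e)
    (by simpa using hw.continuous.integrable_of_hasCompactSupport hc)
    (fun x _ => by fun_prop) (fun x _ => hw.differentiable one_ne_zero x)
  simpa [inner_gradient_eq] using key

theorem hasWeakDivergence_smul_const {k : E → ℝ} {U : Set E} (hU : IsOpen U)
    (hk : ContDiffOn ℝ 1 k U) (e : E) :
    HasWeakDivergence U (fun x => k x • e) (fun x => ⟪∇ k x, e⟫_ℝ) := by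
  intro φ hφ
  have h := hφ.mul_left_of_contDiffOn hU hk
  rw [← integral_inner_gradient_eq_zero h.contDiff h.compact e]
  exact integral_congr_ae (.of_forall fun x => (inner_gradient_mul hU hk hφ e x).symm)

namespace HasWeakDivergence

variable {W W' : Set E} {X Y : E → E} {h k : E → ℝ}

theorem mono (hX : HasWeakDivergence W X h) (hW : W' ⊆ W) : HasWeakDivergence W' X h :=
  fun φ hφ => hX φ (hφ.mono hW)

theorem neg (hX : HasWeakDivergence W X h) :
    HasWeakDivergence W (fun x => - X x) (fun x => - h x) := by
  intro φ hφ
  have := hX φ hφ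
  rw [← neg_eq_zero, ← integral_neg] at this
  rw [← this]
  congr 1
  ext x
  rw [inner_neg_left]
  ring

theorem sub (hX : HasWeakDivergence W X h) (hY : HasWeakDivergence W Y k)
    (hXi : LocallyIntegrableOn X W volume) (hhi : LocallyIntegrableOn h W volume)
    (hYi : LocallyIntegrableOn Y W volume) (hki : LocallyIntegrableOn k W volume) :
    HasWeakDivergence W (fun x => X x - Y x) (fun x => h x - k x) := by
  intro φ hφ
  have := integral_sub (hφ.integrable hXi hhi) (hφ.integrable hYi hki)
  rw [hX φ hφ, hY φ hφ, sub_zero] at this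
  rw [← this]
  congr 1
  ext x
  rw [inner_sub_left]
  ring

end HasWeakDivergence

end WeakDivergence

/-- The integrand is `∑ᵢ ∂ᵢ(Xᵢ φ)`, and each summand is a derivative of a compactly supported `C¹`
function. -/
theorem hasWeakDivergence_of_contDiffOn {m : ℕ} {U : Set (EuclideanSpace ℝ (Fin m))}
    (hU : IsOpen U) {X : EuclideanSpace ℝ (Fin m) → EuclideanSpace ℝ (Fin m)}
    {h : EuclideanSpace ℝ (Fin m) → ℝ} (hX : ContDiffOn ℝ 1 X U)
    (hdiv : ∀ x ∈ U, divergence X x = h x) : HasWeakDivergence U X h := by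
  intro φ hφ
  have hXd : ∀ x ∈ U, DifferentiableAt ℝ X x := fun x hx =>
    (hX.differentiableOn one_ne_zero).differentiableAt (hU.mem_nhds hx)
  have hw : ∀ i, IsC1Test U (fun x => X x i * φ x) := fun i =>
    hφ.mul_left_of_contDiffOn hU (contDiffOn_euclidean.1 hX i)
  have key : ∀ x, ⟪X x, ∇ φ x⟫_ℝ + h x * φ x =
      ∑ i, ⟪∇ (fun x => X x i * φ x) x, EuclideanSpace.single i 1⟫_ℝ := by
    intro x
    by_cases hx : x ∈ tsupport φ
    · have hxd := hXd x (hφ.supp hx)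
      have hxi : ∀ i, HasFDerivAt (fun y => X y i)
          ((EuclideanSpace.proj i : EuclideanSpace ℝ (Fin m) →L[ℝ] ℝ).comp (fderiv ℝ X x)) x :=
        fun i => (EuclideanSpace.proj i : EuclideanSpace ℝ (Fin m) →L[ℝ] ℝ).hasFDerivAt.comp x
          hxd.hasFDerivAt
      have h2 : ∀ i, ⟪∇ (fun x => X x i * φ x) x, EuclideanSpace.single i (1 : ℝ)⟫_ℝ =
          X x i * (∇ φ x) i + (fderiv ℝ X x (EuclideanSpace.single i 1)) i * φ x := by
        intro i
        rw [gradient_mul_apply (hxi i).differentiableAt (hφ.differentiableAt x), inner_add_left,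
          real_inner_smul_left, real_inner_smul_left, inner_gradient_eq (fun x => X x i),
          (hxi i).fderiv]
        simp [mul_comm, EuclideanSpace.inner_single_right, -inner_gradient_left]
      simp_rw [h2]
      rw [Finset.sum_add_distrib, ← Finset.sum_mul, ← hdiv x (hφ.supp hx), divergence]
      congr 1
      simp [PiLp.inner_apply, mul_comm, -inner_gradient_right]
    · have h1 : ∀ i, ∇ (fun x => X x i * φ x) x = 0 := by
        intro i
        apply gradient_eq_zero_of_notMem_tsupport
        exact fun hx' => hx (tsupport_mul_subset_right hx')
      simp [h1, gradient_eq_zero_of_notMem_tsupport hx, image_eq_zero_of_notMem_tsupport hx]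
  simp_rw [key]
  rw [integral_finsetSum _ fun i _ => integrable_inner_gradient (hw i).contDiff (hw i).compact _]
  exact Finset.sum_eq_zero fun i _ => integral_inner_gradient_eq_zero (hw i).contDiff
    (hw i).compact _

/-! ### Removability of closed sets of zero codimension-one Hausdorff measure. -/

section Removability

/-- In the Leibniz expansion each `∇ (ψ i)` is multiplied by factors in `[0, 1]`, so the gradients
of the bumps simply add up. -/
theorem contDiff_prod_one_sub_and_enorm_gradient_le {E : Type*} [NormedAddCommGroup E] [InnerProductSpace ℝ E]
    [CompleteSpace E] (ι : Finset ℕ) (ψ : ℕ → E → ℝ)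
    (hψ : ∀ i ∈ ι, ContDiff ℝ 1 (ψ i)) (hψ1 : ∀ i ∈ ι, ∀ x, ψ i x ∈ Icc (0 : ℝ) 1) :
    ContDiff ℝ 1 (fun x => ∏ i ∈ ι, (1 - ψ i x)) ∧
      (∀ x, (∏ i ∈ ι, (1 - ψ i x)) ∈ Icc (0 : ℝ) 1) ∧
      ∀ x, ‖∇ (fun x => ∏ i ∈ ι, (1 - ψ i x)) x‖ₑ ≤ ∑ i ∈ ι, ‖∇ (ψ i) x‖ₑ := by
  classical
  induction ι using Finset.induction_on with
  | empty => exact ⟨by simpa using contDiff_const, by simp, by simp⟩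
  | insert a s ha ih =>
    obtain ⟨h1, h2, h3⟩ := ih (fun i hi => hψ i (Finset.mem_insert_of_mem hi))
      (fun i hi => hψ1 i (Finset.mem_insert_of_mem hi))
    have ha1 := hψ a (Finset.mem_insert_self a s)
    have ha2 := hψ1 a (Finset.mem_insert_self a s)
    have ha3 : ContDiff ℝ 1 (fun x => 1 - ψ a x) := contDiff_const.sub ha1
    simp only [Finset.prod_insert ha, Finset.sum_insert ha]
    refine ⟨ha3.mul h1, fun x => ⟨mul_nonneg (by linarith [(ha2 x).2]) (h2 x).1,
      mul_le_one₀ (by linarith [(ha2 x).1]) (h2 x).1 (h2 x).2⟩, fun x => ?_⟩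
    rw [gradient_mul_apply (ha3.differentiable one_ne_zero x) (h1.differentiable one_ne_zero x),
      gradient_one_sub_apply, add_comm]
    have e1 : ∀ (c : ℝ) (w : E), c ∈ Icc (0 : ℝ) 1 → ‖c • w‖ₑ ≤ ‖w‖ₑ := by
      intro c w hc
      rw [enorm_smul]
      refine mul_le_of_le_one_left zero_le ?_
      rw [← ofReal_norm, Real.norm_of_nonneg hc.1]
      simpa using hc.2
    refine (enorm_add_le _ _).trans (add_le_add ?_ ?_)
    · refine (e1 _ _ (h2 x)).trans ?_
      rw [enorm_neg]
    · exact (e1 _ _ ⟨by linarith [(ha2 x).2], by linarith [(ha2 x).1]⟩).trans (h3 x)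

variable {E : Type*} [NormedAddCommGroup E] [InnerProductSpace ℝ E] [FiniteDimensional ℝ E]
  [MeasurableSpace E] [BorelSpace E]

variable (E) in
-- Scaling: a bump of radius `r` has gradient of size `B / r` on a ball of volume `c r ^ d`, and `C`
-- depends on neither centre nor radius. The restriction `r ≤ 1` lets the volume `c r ^ d` obey the
-- same bound.
theorem exists_bump_lintegral_gradient_le (hd : 1 ≤ Module.finrank ℝ E) :
    ∃ C : ENNReal, C ≠ ⊤ ∧ ∀ (x₀ : E) (r : ℝ), 0 < r → r ≤ 1 → ∃ ψ : E → ℝ, ContDiff ℝ 1 ψ ∧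
      (∀ x, ψ x ∈ Icc (0 : ℝ) 1) ∧ (∀ x ∈ Metric.ball x₀ r, ψ x = 1) ∧
      volume {x | ψ x ≠ 0} ≤ C * ENNReal.ofReal r ^ ((Module.finrank ℝ E : ℝ) - 1) ∧
      ∫⁻ x, ‖∇ ψ x‖ₑ ≤ C * ENNReal.ofReal r ^ ((Module.finrank ℝ E : ℝ) - 1) := by
  set d := Module.finrank ℝ E with hd_def
  let f : ContDiffBump (0 : E) := ⟨1, 2, one_pos, one_lt_two⟩
  have hf1 : ContDiff ℝ 1 f := f.contDiff
  obtain ⟨B, hB⟩ : ∃ B, ∀ x, ‖∇ f x‖ ≤ B := by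
    obtain ⟨B, hB⟩ := (f.hasCompactSupport : IsCompact (tsupport f)).exists_bound_of_continuousOn
      hf1.continuous_gradient.continuousOn
    refine ⟨max B 0, fun x => ?_⟩
    by_cases hx : x ∈ tsupport f
    · exact (hB x hx).trans (le_max_left _ _)
    · simp [gradient_eq_zero_of_notMem_tsupport hx]
  have hB0 : 0 ≤ B := (norm_nonneg _).trans (hB 0)
  set v : ENNReal := volume (Metric.ball (0 : E) 1) with hv
  have hvt : v ≠ ⊤ := measure_ball_lt_top.ne
  set c : ENNReal := ENNReal.ofReal (2 ^ d) * v with hc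
  refine ⟨(1 + ENNReal.ofReal B) * c, by finiteness, fun x₀ r hr hr1 => ?_⟩
  have hpow : ENNReal.ofReal r ^ ((d : ℝ) - 1) = ENNReal.ofReal (r ^ (d - 1)) := by
    rw [ENNReal.ofReal_pow hr.le, ← ENNReal.rpow_natCast, Nat.cast_sub hd, Nat.cast_one]
  rw [hpow]
  have hvol : volume (Metric.closedBall x₀ (2 * r)) = c * ENNReal.ofReal (r ^ d) := by
    rw [Measure.addHaar_closedBall _ _ (by positivity), mul_pow, ENNReal.ofReal_mul (by positivity),
      hc, ← hd_def]
    ring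
  have hrd : r ^ d = r * r ^ (d - 1) := by
    rw [← pow_succ', Nat.sub_add_cancel hd]
  have hsupp : ∀ x, x ∉ Metric.closedBall x₀ (2 * r) → f (r⁻¹ • (x - x₀)) = 0 := by
    intro x hx
    apply f.zero_of_le_dist
    rw [Metric.mem_closedBall, not_le, dist_eq_norm] at hx
    rw [dist_zero_right, norm_smul, norm_inv, Real.norm_of_nonneg hr.le]
    change (2 : ℝ) ≤ _
    rw [inv_mul_eq_div, le_div_iff₀ hr]
    exact hx.le
  refine ⟨fun x => f (r⁻¹ • (x - x₀)), hf1.comp (by fun_prop), fun x => ⟨f.nonneg, f.le_one⟩,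
    fun x hx => ?_, ?_, ?_⟩
  · apply f.one_of_mem_closedBall
    rw [Metric.mem_ball, dist_eq_norm] at hx
    rw [mem_closedBall_zero_iff, norm_smul, norm_inv, Real.norm_of_nonneg hr.le]
    change _ ≤ (1 : ℝ)
    rw [inv_mul_eq_div, div_le_one hr]
    exact hx.le
  · calc volume {x | f (r⁻¹ • (x - x₀)) ≠ 0} ≤ volume (Metric.closedBall x₀ (2 * r)) :=
          measure_mono fun x hx => by_contra fun hx' => hx (hsupp x hx')
      _ = c * ENNReal.ofReal (r ^ d) := hvol
      _ ≤ c * ENNReal.ofReal (r ^ (d - 1)) := by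
          refine mul_le_mul_right (ENNReal.ofReal_le_ofReal ?_) c
          rw [hrd]
          exact mul_le_of_le_one_left (by positivity) hr1
      _ ≤ (1 + ENNReal.ofReal B) * c * ENNReal.ofReal (r ^ (d - 1)) := by
          gcongr
          exact le_mul_of_one_le_left zero_le (by simp)
  · have hgrad : ∀ x, ‖∇ (fun x => f (r⁻¹ • (x - x₀))) x‖ₑ ≤
        (Metric.closedBall x₀ (2 * r)).indicator (fun _ => ENNReal.ofReal (B / r)) x := by
      intro x
      by_cases hx : x ∈ Metric.closedBall x₀ (2 * r)
      · rw [indicator_of_mem hx, ← ofReal_norm]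
        apply ENNReal.ofReal_le_ofReal
        have h1 : HasFDerivAt (fun x => f (r⁻¹ • (x - x₀)))
            ((fderiv ℝ f (r⁻¹ • (x - x₀))).comp (r⁻¹ • ContinuousLinearMap.id ℝ E)) x :=
          ((hf1.differentiable one_ne_zero _).hasFDerivAt).comp x
            (((hasFDerivAt_id x).sub_const x₀).const_smul r⁻¹)
        have h2 : ∇ (fun x => f (r⁻¹ • (x - x₀))) x = r⁻¹ • ∇ f (r⁻¹ • (x - x₀)) := by
          rw [gradient_eq_toDual_symm, h1.fderiv, gradient_eq_toDual_symm]
          rw [← map_smul]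
          congr 1
          ext y
          simp
        rw [h2, norm_smul, norm_inv, Real.norm_of_nonneg hr.le, inv_mul_eq_div]
        gcongr
        exact hB _
      · have h3 : x ∉ tsupport (fun x => f (r⁻¹ • (x - x₀))) := by
          intro hx'
          refine hx ((closure_minimal ?_ Metric.isClosed_closedBall) hx')
          exact fun y hy => by_contra fun hy' => hy (hsupp y hy')
        rw [gradient_eq_zero_of_notMem_tsupport h3]
        simp
    calc ∫⁻ x, ‖∇ (fun x => f (r⁻¹ • (x - x₀))) x‖ₑ
        ≤ ∫⁻ x, (Metric.closedBall x₀ (2 * r)).indicator (fun _ => ENNReal.ofReal (B / r)) x :=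
          lintegral_mono hgrad
      _ = ENNReal.ofReal (B / r) * (c * ENNReal.ofReal (r ^ d)) := by
          rw [lintegral_indicator_const Metric.isClosed_closedBall.measurableSet, hvol]
      _ = c * ENNReal.ofReal (B * r ^ (d - 1)) := by
          rw [mul_left_comm, ← ENNReal.ofReal_mul (by positivity), hrd]
          congr 2
          field_simp
      _ = ENNReal.ofReal B * c * ENNReal.ofReal (r ^ (d - 1)) := by
          rw [ENNReal.ofReal_mul hB0]
          ring
      _ ≤ (1 + ENNReal.ofReal B) * c * ENNReal.ofReal (r ^ (d - 1)) := by
          gcongr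
          simp

/-- Each nonempty set of an efficient cover is replaced by an open ball around one of its points,
with radius slightly larger than the diameter; the excess is paid by a summable sequence `δ`. Strict
enlargement also handles sets of diameter zero, and openness allows a finite subcover. -/
theorem exists_ball_cover_of_hausdorffMeasure_eq_zero {X : Type*} [MetricSpace X] [Nonempty X]
    [MeasurableSpace X] [BorelSpace X] {a : ℝ} (ha : 0 ≤ a) {K : Set X} (hK : IsCompact K)
    (h0 : Measure.hausdorffMeasure a K = 0) {ε : ENNReal} (hε : 0 < ε) :
    ∃ (ι : Finset ℕ) (x : ℕ → X) (r : ℕ → ℝ), (∀ i ∈ ι, 0 < r i ∧ r i ≤ 1) ∧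
      K ⊆ ⋃ i ∈ ι, Metric.ball (x i) (r i) ∧ ∑ i ∈ ι, ENNReal.ofReal (r i) ^ a ≤ ε := by
  classical
  obtain ⟨δ, hδ0, hδ⟩ := ENNReal.exists_pos_sum_of_countable (ENNReal.half_pos hε.ne').ne' ℕ
  rw [Measure.hausdorffMeasure_apply] at h0
  have h1 := le_of_eq h0
  -- Any scale below `1` would do: it leaves room for a radius larger than the diameter but still at
  -- most `1`.
  have h2 := (iSup₂_le_iff.1 h1) (1 / 2) (by simp)
  have h3 := lt_of_le_of_lt h2 (ENNReal.half_pos hε.ne')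
  simp only [iInf_lt_iff] at h3
  obtain ⟨t, htK, htd, hts⟩ := h3
  have hchoice : ∀ n, ∃ (y : X) (r : ℝ), (t n).Nonempty →
      0 < r ∧ r ≤ 1 ∧ t n ⊆ Metric.ball y r ∧
      ENNReal.ofReal r ^ a ≤ Metric.ediam (t n) ^ a + δ n := by
    intro n
    by_cases hn : (t n).Nonempty
    · obtain ⟨y, hy⟩ := hn
      have hlt1 : Metric.ediam (t n) < 1 := (htd n).trans_lt (by simp)
      have hfin : Metric.ediam (t n) ^ a ≠ ⊤ := ENNReal.rpow_ne_top_of_nonneg ha hlt1.ne_top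
      have hcont : ∀ᶠ s in 𝓝 (Metric.ediam (t n)), s ^ a < Metric.ediam (t n) ^ a + δ n :=
        (ENNReal.continuous_rpow_const (y := a)).continuousAt.eventually_lt continuousAt_const
          (ENNReal.lt_add_right hfin (by simpa using (hδ0 n).ne'))
      have : (𝓝[>] Metric.ediam (t n)).NeBot := nhdsGT_neBot_of_exists_gt ⟨1, hlt1⟩
      have hgt : ∀ᶠ s in 𝓝[>] Metric.ediam (t n), Metric.ediam (t n) < s := self_mem_nhdsWithin
      obtain ⟨s, hs1, hs2, hs3⟩ := ((hcont.filter_mono nhdsWithin_le_nhds).and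
        (((eventually_lt_nhds hlt1).filter_mono nhdsWithin_le_nhds).and hgt)).exists
      have hst : s ≠ ⊤ := hs2.ne_top
      refine ⟨y, s.toReal, fun _ => ⟨ENNReal.toReal_pos (pos_of_gt hs3).ne' hst, ?_, ?_, ?_⟩⟩
      · exact ENNReal.toReal_le_of_le_ofReal zero_le_one (by simpa using hs2.le)
      · intro z hz
        rw [Metric.mem_ball, dist_edist]
        exact (ENNReal.toReal_lt_toReal (edist_ne_top _ _) hst).2
          ((Metric.edist_le_ediam_of_mem hz hy).trans_lt hs3)
      · rw [ENNReal.ofReal_toReal hst]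
        exact hs1.le
    · exact ⟨Classical.arbitrary X, 0, fun h => absurd h hn⟩
  choose y r hr using hchoice
  obtain ⟨b, hb, hbf, hbK⟩ := hK.elim_finite_subcover_image (b := {n | (t n).Nonempty})
    (c := fun n => Metric.ball (y n) (r n)) (fun _ _ => Metric.isOpen_ball) (by
      intro z hz
      obtain ⟨n, hn⟩ := mem_iUnion.1 (htK hz)
      exact mem_iUnion₂.2 ⟨n, ⟨z, hn⟩, (hr n ⟨z, hn⟩).2.2.1 hn⟩)
  refine ⟨hbf.toFinset, y, r, fun i hi => ?_, by simpa using hbK, ?_⟩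
  · have := hr i (hb (by simpa using hi))
    exact ⟨this.1, this.2.1⟩
  · calc ∑ i ∈ hbf.toFinset, ENNReal.ofReal (r i) ^ a
        ≤ ∑ i ∈ hbf.toFinset, ((⨆ _ : (t i).Nonempty, Metric.ediam (t i) ^ a) + δ i) := by
          refine Finset.sum_le_sum fun i hi => ?_
          have hi' : (t i).Nonempty := hb (by simpa using hi)
          rw [iSup_pos hi']
          exact (hr i hi').2.2.2
      _ ≤ ∑' i, ((⨆ _ : (t i).Nonempty, Metric.ediam (t i) ^ a) + δ i) := ENNReal.sum_le_tsum _
      _ ≤ ε / 2 + ε / 2 := by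
          rw [ENNReal.tsum_add]
          exact add_le_add hts.le hδ.le
      _ = ε := ENNReal.add_halves ε

theorem exists_cutoff_of_hausdorffMeasure_eq_zero (hd : 1 ≤ Module.finrank ℝ E) {K : Set E}
    (hK : IsCompact K) (h0 : Measure.hausdorffMeasure ((Module.finrank ℝ E : ℝ) - 1) K = 0)
    {ε : ENNReal} (hε : 0 < ε) :
    ∃ η : E → ℝ, ContDiff ℝ 1 η ∧ (∀ x, η x ∈ Icc (0 : ℝ) 1) ∧ Disjoint (tsupport η) K ∧
      volume {x | η x ≠ 1} ≤ ε ∧ ∫⁻ x, ‖∇ η x‖ₑ ≤ ε := by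
  obtain ⟨C, hC, hbump⟩ := exists_bump_lintegral_gradient_le E hd
  have ha : (0 : ℝ) ≤ (Module.finrank ℝ E : ℝ) - 1 := by
    have : (1 : ℝ) ≤ Module.finrank ℝ E := by exact_mod_cast hd
    linarith
  obtain ⟨ε', hε', hCε⟩ : ∃ ε' : ENNReal, 0 < ε' ∧ C * ε' ≤ ε := by
    rcases eq_or_ne C 0 with h | h
    · exact ⟨1, one_pos, by simp [h]⟩
    · exact ⟨ε / C, ENNReal.div_pos hε.ne' hC, ENNReal.mul_div_le⟩
  obtain ⟨ι, x, r, hr, hKι, hsum⟩ := exists_ball_cover_of_hausdorffMeasure_eq_zero ha hK h0 hε'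
  have hch : ∀ i, ∃ ψ : E → ℝ, i ∈ ι → ContDiff ℝ 1 ψ ∧
      (∀ x, ψ x ∈ Icc (0 : ℝ) 1) ∧ (∀ y ∈ Metric.ball (x i) (r i), ψ y = 1) ∧
      volume {x | ψ x ≠ 0} ≤ C * ENNReal.ofReal (r i) ^ ((Module.finrank ℝ E : ℝ) - 1) ∧
      ∫⁻ x, ‖∇ ψ x‖ₑ ≤ C * ENNReal.ofReal (r i) ^ ((Module.finrank ℝ E : ℝ) - 1) := by
    intro i
    by_cases hi : i ∈ ι
    · obtain ⟨ψ, hψ⟩ := hbump (x i) (r i) (hr i hi).1 (hr i hi).2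
      exact ⟨ψ, fun _ => hψ⟩
    · exact ⟨0, fun h => absurd h hi⟩
  choose ψ hψ using hch
  obtain ⟨h1, h2, h3⟩ := contDiff_prod_one_sub_and_enorm_gradient_le ι ψ (fun i hi => (hψ i hi).1)
    (fun i hi => (hψ i hi).2.1)
  have hbound : ∑ i ∈ ι, C * ENNReal.ofReal (r i) ^ ((Module.finrank ℝ E : ℝ) - 1) ≤ ε := by
    rw [← Finset.mul_sum]
    exact (mul_le_mul_right hsum C).trans hCε
  refine ⟨_, h1, h2, ?_, ?_, ?_⟩
  · have hopen : IsOpen (⋃ i ∈ ι, Metric.ball (x i) (r i)) :=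
      isOpen_biUnion fun _ _ => Metric.isOpen_ball
    refine Disjoint.mono_right hKι (Disjoint.closure_left ?_ hopen)
    rw [Set.disjoint_left]
    intro z hz hz'
    obtain ⟨i, hi, hzi⟩ := mem_iUnion₂.1 hz'
    exact hz (Finset.prod_eq_zero hi (by rw [(hψ i hi).2.2.1 z hzi, sub_self]))
  · calc volume {x | ∏ i ∈ ι, (1 - ψ i x) ≠ 1} ≤ volume (⋃ i ∈ ι, {x | ψ i x ≠ 0}) := by
          refine measure_mono fun z hz => ?_
          by_contra hz'
          simp only [mem_iUnion, mem_ofPred_eq, not_exists, not_not] at hz'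
          exact hz (Finset.prod_eq_one fun i hi => by rw [hz' i hi, sub_zero])
      _ ≤ ∑ i ∈ ι, volume {x | ψ i x ≠ 0} := measure_biUnion_finset_le _ _
      _ ≤ _ := (Finset.sum_le_sum fun i hi => (hψ i hi).2.2.2.1).trans hbound
  · calc ∫⁻ z, ‖∇ (fun x => ∏ i ∈ ι, (1 - ψ i x)) z‖ₑ ≤ ∫⁻ z, ∑ i ∈ ι, ‖∇ (ψ i) z‖ₑ :=
          lintegral_mono h3
      _ = ∑ i ∈ ι, ∫⁻ z, ‖∇ (ψ i) z‖ₑ := by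
          refine lintegral_finsetSum' _ fun i hi => ?_
          exact (hψ i hi).1.continuous_gradient.enorm.aemeasurable
      _ ≤ _ := (Finset.sum_le_sum fun i hi => (hψ i hi).2.2.2.2).trans hbound

/-- Test with `η φ`, where the cutoff `η` vanishes near the relevant part of `C`. The error consists
of an integral over `{η ≠ 1}`, small by absolute continuity, and of `φ ⟪X, ∇η⟫`, small in `L¹`
because `X` is bounded. The density `h` need only be locally integrable. -/
theorem HasWeakDivergence.of_diff (hd : 1 ≤ Module.finrank ℝ E) {W C : Set E} {X : E → E}
    {h : E → ℝ} {B : ℝ} (hC : IsClosed C)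
    (h0 : Measure.hausdorffMeasure ((Module.finrank ℝ E : ℝ) - 1) C = 0)
    (hX : HasWeakDivergence (W \ C) X h) (hXi : LocallyIntegrableOn X W volume)
    (hhi : LocallyIntegrableOn h W volume) (hB : ∀ x, ‖X x‖ ≤ B) :
    HasWeakDivergence W X h := by
  intro φ hφ
  set g : E → ℝ := fun x => ⟪X x, ∇ φ x⟫_ℝ + h x * φ x with hg
  have hgi : Integrable g volume := hφ.integrable hXi hhi
  obtain ⟨M, hM⟩ : ∃ M, ∀ x, ‖φ x‖ ≤ M :=
    hφ.contDiff.continuous.bounded_above_of_compact_support hφ.compact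
  have hK : IsCompact (tsupport φ ∩ C) := IsCompact.inter_right hφ.compact hC
  have hK0 := measure_mono_null (inter_subset_right : tsupport φ ∩ C ⊆ C) h0
  have hε : ∀ n : ℕ, (0 : ENNReal) < ((n : ENNReal) + 1)⁻¹ := by
    intro n
    simp
  choose η hη1 hη2 hη3 hη4 hη5 using fun n =>
    exists_cutoff_of_hausdorffMeasure_eq_zero hd hK hK0 (hε n)
  have hlim : Tendsto (fun n : ℕ => ((n : ENNReal) + 1)⁻¹) atTop (𝓝 0) := by
    have := (tendsto_add_atTop_iff_nat 1).2 ENNReal.tendsto_inv_nat_nhds_zero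
    simpa using this
  have hM0 : 0 ≤ M := (norm_nonneg _).trans (hM 0)
  have hB0 : 0 ≤ B := (norm_nonneg _).trans (hB 0)
  have hbound : ∀ n, |∫ x, g x| ≤
      (∫ x in {x | η n x ≠ 1}, |g x|) + M * B * (((n : ENNReal) + 1)⁻¹).toReal := by
    intro n
    have htest : IsC1Test (W \ C) (fun x => η n x * φ x) := by
      have ht := hφ.mul_left (hη1 n)
      refine ⟨ht.contDiff, ht.compact, fun x hx => ⟨ht.supp hx, fun hxC => ?_⟩⟩
      have hx1 : x ∈ tsupport (η n) := tsupport_mul_subset_left hx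
      have hx2 : x ∈ tsupport φ := tsupport_mul_subset_right hx
      exact (Set.disjoint_left.1 (hη3 n)) hx1 ⟨hx2, hxC⟩
    have hzero := hX _ htest
    have hint := (htest.mono sdiff_subset).integrable hXi hhi
    have hid : ∀ x, ⟪X x, ∇ (fun x => η n x * φ x) x⟫_ℝ + h x * (η n x * φ x) =
        η n x * g x + φ x * ⟪X x, ∇ (η n) x⟫_ℝ := by
      intro x
      rw [gradient_mul_apply ((hη1 n).differentiable one_ne_zero x) (hφ.differentiableAt x),
        inner_add_right, real_inner_smul_right, real_inner_smul_right]
      ring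
    simp_rw [hid] at hzero hint
    have hηg : Integrable (fun x => η n x * g x) volume := by
      refine hgi.bdd_mul (c := 1) (hη1 n).continuous.aestronglyMeasurable (.of_forall fun x => ?_)
      rw [Real.norm_of_nonneg (hη2 n x).1]
      exact (hη2 n x).2
    have hφη : Integrable (fun x => φ x * ⟪X x, ∇ (η n) x⟫_ℝ) volume := by
      have := hint.sub hηg
      refine this.congr (.of_forall fun x => ?_)
      simp
    rw [integral_add hηg hφη] at hzero
    have hηc : Integrable (fun x => (1 - η n x) * g x) volume := by
      refine (hgi.sub hηg).congr (.of_forall fun x => ?_)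
      simp [sub_mul]
    have hsplit : ∫ x, g x = (∫ x, (1 - η n x) * g x) - ∫ x, φ x * ⟪X x, ∇ (η n) x⟫_ℝ := by
      have e : ∫ x, g x = (∫ x, (1 - η n x) * g x) + ∫ x, η n x * g x := by
        rw [← integral_add hηc hηg]
        congr 1
        ext x
        ring
      rw [e]
      linarith
    have hms : MeasurableSet {x | η n x ≠ 1} :=
      ((isClosed_singleton (x := (1 : ℝ))).preimage (hη1 n).continuous).measurableSet.compl
    have b1 : |∫ x, (1 - η n x) * g x| ≤ ∫ x in {x | η n x ≠ 1}, |g x| := by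
      rw [← integral_indicator hms]
      refine (abs_integral_le_integral_abs).trans (integral_mono_ae hηc.abs
        (hgi.abs.indicator hms) (.of_forall fun x => ?_))
      by_cases hx : η n x = 1
      · simp [hx]
      · simp only [indicator_of_mem (show x ∈ {x | η n x ≠ 1} from hx)]
        rw [abs_mul]
        refine mul_le_of_le_one_left (abs_nonneg _) ?_
        rw [abs_le]
        constructor <;> linarith [(hη2 n x).1, (hη2 n x).2]
    have hgradi : Integrable (fun x => ∇ (η n) x) volume :=
      ⟨(hη1 n).continuous_gradient.aestronglyMeasurable,
        (hη5 n).trans_lt (ENNReal.inv_lt_top.2 (by positivity))⟩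
    have b2 : |∫ x, φ x * ⟪X x, ∇ (η n) x⟫_ℝ| ≤ M * B * (((n : ENNReal) + 1)⁻¹).toReal := by
      calc |∫ x, φ x * ⟪X x, ∇ (η n) x⟫_ℝ| ≤ ∫ x, M * B * ‖∇ (η n) x‖ := by
            refine (abs_integral_le_integral_abs).trans (integral_mono_ae hφη.abs
              (hgradi.norm.const_mul _) (.of_forall fun x => ?_))
            simp only [abs_mul]
            rw [mul_assoc]
            refine mul_le_mul (hM x) ?_ (abs_nonneg _) hM0
            exact (abs_real_inner_le_norm _ _).trans
              (mul_le_mul_of_nonneg_right (hB x) (norm_nonneg _))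
        _ = M * B * (∫⁻ x, ‖∇ (η n) x‖ₑ).toReal := by
            rw [integral_const_mul, integral_norm_eq_lintegral_enorm hgradi.1]
        _ ≤ _ := by
            gcongr
            · simp
            · exact hη5 n
    rw [hsplit]
    exact (abs_sub _ _).trans (add_le_add b1 b2)
  have hvol : Tendsto (fun n => volume {x | η n x ≠ 1}) atTop (𝓝 0) :=
    tendsto_of_tendsto_of_tendsto_of_le_of_le tendsto_const_nhds hlim (fun _ => zero_le)
      hη4
  have hl1 := hgi.abs.tendsto_setIntegral_nhds_zero hvol
  have hl2 : Tendsto (fun n : ℕ => M * B * (((n : ENNReal) + 1)⁻¹).toReal) atTop (𝓝 0) := by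
    have := ((ENNReal.tendsto_toReal (ENNReal.zero_ne_top)).comp hlim).const_mul (M * B)
    simpa using this
  have := ge_of_tendsto (hl1.add hl2) (.of_forall hbound)
  rw [add_zero] at this
  exact abs_eq_zero.1 (le_antisymm this (abs_nonneg _))

end Removability

/-! ### Weak divergence is a local property. -/

section Locality

variable {E : Type*} [NormedAddCommGroup E] [InnerProductSpace ℝ E] [FiniteDimensional ℝ E]

theorem exists_contDiff_cutoff {K U : Set E} (hK : IsCompact K) (hU : IsOpen U) (hKU : K ⊆ U) :
    ∃ η : E → ℝ, ContDiff ℝ 1 η ∧ (∀ x, η x ∈ Icc (0 : ℝ) 1) ∧ HasCompactSupport η ∧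
      tsupport η ⊆ U ∧ ∀ x ∈ K, η =ᶠ[𝓝 x] fun _ => 1 := by
  obtain ⟨L, hL, hKL, hLU⟩ := exists_compact_between hK hU hKU
  obtain ⟨f, hf0, hf1, hf⟩ := exists_contMDiffMap_zero_one_nhds_of_isClosed (n := 1)
    (modelWithCornersSelf ℝ E) (isOpen_interior (s := L)).isClosed_compl hK.isClosed
    (disjoint_compl_left_iff_subset.2 hKL)
  have hts : tsupport f ⊆ L := by
    refine closure_minimal (fun x hx => ?_) hL.isClosed
    by_contra hx'
    exact hx (hf0.self_of_nhdsSet x fun h => hx' (interior_subset h))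
  exact ⟨f, f.contMDiff.contDiff, hf, hL.of_isClosed_subset (isClosed_tsupport _) hts,
    hts.trans hLU, fun x hx => hf1.filter_mono (nhds_le_nhdsSet hx)⟩

variable [MeasurableSpace E] [BorelSpace E]

theorem HasWeakDivergence.union {U₁ U₂ : Set E} {X : E → E} {h : E → ℝ} (hU₁ : IsOpen U₁)
    (hU₂ : IsOpen U₂) (h₁ : HasWeakDivergence U₁ X h) (h₂ : HasWeakDivergence U₂ X h)
    (hX : LocallyIntegrableOn X (U₁ ∪ U₂) volume) (hh : LocallyIntegrableOn h (U₁ ∪ U₂) volume) :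
    HasWeakDivergence (U₁ ∪ U₂) X h := by
  intro φ hφ
  -- A two-piece partition of unity on the support: with `η = 1` near this compact set, `(1 - η) φ`
  -- is supported in `U₂`.
  have hK : IsCompact (tsupport φ \ U₂) := IsCompact.diff hφ.compact hU₂
  obtain ⟨η, hη, -, -, hηU, hη1⟩ := exists_contDiff_cutoff hK hU₁
    (fun x hx => (hφ.supp hx.1).resolve_right hx.2)
  have t₁ : IsC1Test U₁ (fun x => η x * φ x) :=
    ⟨hη.mul hφ.contDiff, hφ.compact.mul_left, tsupport_mul_subset_left.trans hηU⟩
  have t₂ : IsC1Test U₂ (fun x => (1 - η x) * φ x) := by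
    refine ⟨(contDiff_const.sub hη).mul hφ.contDiff, hφ.compact.mul_left, fun x hx => ?_⟩
    by_contra hx2
    refine notMem_tsupport_iff_eventuallyEq.2 ?_ hx
    filter_upwards [hη1 x ⟨tsupport_mul_subset_right hx, hx2⟩] with y hy
    simp [hy]
  have e := integral_add ((t₁.mono subset_union_left).integrable hX hh)
    ((t₂.mono subset_union_right).integrable hX hh)
  rw [h₁ _ t₁, h₂ _ t₂, add_zero] at e
  rw [← e]
  congr 1
  ext x
  have : ∇ φ x = ∇ (fun x => η x * φ x) x + ∇ (fun x => (1 - η x) * φ x) x := by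
    rw [← gradient_add_apply (t₁.differentiableAt x) (t₂.differentiableAt x)]
    congr 1
    ext y
    ring
  rw [this, inner_add_right]
  ring

theorem HasWeakDivergence.of_locally {W : Set E} {X : E → E} {h : E → ℝ}
    (hX : LocallyIntegrableOn X W volume) (hh : LocallyIntegrableOn h W volume)
    (H : ∀ x ∈ W, ∃ U, IsOpen U ∧ x ∈ U ∧ U ⊆ W ∧ HasWeakDivergence U X h) :
    HasWeakDivergence W X h := by
  intro φ hφ
  have key : ∃ U, IsOpen U ∧ tsupport φ ⊆ U ∧ U ⊆ W ∧ HasWeakDivergence U X h := by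
    refine IsCompact.induction_on (p := fun s => ∃ U, IsOpen U ∧ s ⊆ U ∧ U ⊆ W ∧
      HasWeakDivergence U X h) hφ.compact ?_ ?_ ?_ ?_
    · refine ⟨∅, isOpen_empty, subset_rfl, empty_subset _, fun ψ hψ => ?_⟩
      have h0 : ∀ x, ψ x = 0 := fun x => hψ.eq_zero (notMem_empty x)
      have h1 : ∀ x, ∇ ψ x = 0 := fun x => hψ.gradient_eq_zero (notMem_empty x)
      simp [h0, h1]
    · rintro s t hst ⟨U, h1, h2, h3, h4⟩
      exact ⟨U, h1, hst.trans h2, h3, h4⟩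
    · rintro s t ⟨U, h1, h2, h3, h4⟩ ⟨U', h1', h2', h3', h4'⟩
      exact ⟨U ∪ U', h1.union h1', union_subset_union h2 h2', union_subset h3 h3',
        h4.union h1 h1' h4' (hX.mono_set (union_subset h3 h3'))
          (hh.mono_set (union_subset h3 h3'))⟩
    · intro x hx
      obtain ⟨U, h1, h2, h3, h4⟩ := H x (hφ.supp hx)
      exact ⟨U, mem_nhdsWithin_of_mem_nhds (h1.mem_nhds h2), U, h1, subset_rfl, h3, h4⟩
  obtain ⟨U, -, h2, -, h4⟩ := key
  exact h4 φ ⟨hφ.contDiff, hφ.compact, h2⟩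

end Locality

/-! ### Level sets of functions increasing in a fixed direction. -/

section LevelSets

open scoped Pointwise

variable {E : Type*} [NormedAddCommGroup E] [InnerProductSpace ℝ E]

theorem lt_of_inner_gradient_pos [CompleteSpace E] {B : Set E} {ρ : E → ℝ} {e x : E} {t : ℝ}
    (hB : Convex ℝ B) (hBo : IsOpen B) (hρ : ContDiffOn ℝ 1 ρ B)
    (he : ∀ x ∈ B, 0 < ⟪∇ ρ x, e⟫_ℝ) (ht : 0 < t) (hx : x ∈ B) (hxt : x + t • e ∈ B) :
    ρ x < ρ (x + t • e) := by
  have hseg : ∀ s ∈ Icc 0 t, x + s • e ∈ B := by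
    intro s hs
    have := hB.add_smul_sub_mem hx hxt (t := s / t)
      ⟨div_nonneg hs.1 ht.le, (div_le_one ht).2 hs.2⟩
    rwa [add_sub_cancel_left, smul_smul, div_mul_cancel₀ _ ht.ne'] at this
  have hder : ∀ s ∈ Icc 0 t, HasDerivAt (fun s => ρ (x + s • e)) ⟪∇ ρ (x + s • e), e⟫_ℝ s := by
    intro s hs
    have h1 : DifferentiableAt ℝ ρ (x + s • e) :=
      (hρ.differentiableOn one_ne_zero).differentiableAt (hBo.mem_nhds (hseg s hs))
    have h2 : HasDerivAt (fun s : ℝ => x + s • e) e s := by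
      simpa using ((hasDerivAt_id s).smul_const e).const_add x
    rw [inner_gradient_eq]
    exact h1.hasFDerivAt.comp_hasDerivAt s h2
  obtain ⟨c, hc, hc'⟩ := exists_hasDerivAt_eq_slope (fun s => ρ (x + s • e)) _ ht
    (fun s hs => (hder s hs).continuousAt.continuousWithinAt)
    (fun s hs => hder s (Ioo_subset_Icc_self hs))
  have hpos := he _ (hseg c (Ioo_subset_Icc_self hc))
  rw [hc', sub_zero, zero_smul, add_zero] at hpos
  have := (div_pos_iff_of_pos_right ht).1 hpos
  linarith

variable [FiniteDimensional ℝ E] [MeasurableSpace E] [BorelSpace E]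

/-- Near `p` the function `ρ` increases strictly along `e = ∇ρ(p)`, so translates of its zero set by
different multiples of `e` are disjoint. A bounded measurable set with infinitely many disjoint
translates inside a bounded region is null. -/
theorem volume_zero_set_eq_zero {V : Set E} {ρ : E → ℝ} (hV : IsOpen V) (hρ : ContDiffOn ℝ 1 ρ V)
    (hg : ∀ x ∈ V, ∇ ρ x ≠ 0) : volume {x ∈ V | ρ x = 0} = 0 := by
  refine measure_null_of_locally_null _ fun p hp => ?_
  set e := ∇ ρ p with he
  have hcont : ContinuousOn (fun x => ⟪∇ ρ x, e⟫_ℝ) V :=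
    (hρ.continuousOn_gradient hV).inner continuousOn_const
  have hpos : ∀ᶠ x in 𝓝 p, 0 < ⟪∇ ρ x, e⟫_ℝ := by
    refine (hcont.continuousAt (hV.mem_nhds hp.1)).eventually_const_lt ?_
    exact real_inner_self_pos.2 (hg p hp.1)
  obtain ⟨r, hr, hball⟩ := Metric.eventually_nhds_iff_ball.1
    (hpos.and (hV.eventually_mem hp.1))
  refine ⟨Metric.ball p r ∩ {x ∈ V | ρ x = 0}, inter_mem
    (mem_nhdsWithin_of_mem_nhds (Metric.ball_mem_nhds p hr)) self_mem_nhdsWithin, ?_⟩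
  have hρB : ContDiffOn ℝ 1 ρ (Metric.ball p r) := hρ.mono fun x hx => (hball x hx).2
  have hset : Metric.ball p r ∩ {x ∈ V | ρ x = 0} = Metric.ball p r ∩ ρ ⁻¹' {0} := by
    ext x
    constructor
    · exact fun hx => ⟨hx.1, hx.2.2⟩
    · exact fun hx => ⟨hx.1, (hball x hx.1).2, hx.2⟩
  rw [hset]
  obtain ⟨O, hO, hOe⟩ := (continuousOn_iff_isClosed.1 hρB.continuousOn) {0} isClosed_singleton
  have hmeas : MeasurableSet (Metric.ball p r ∩ ρ ⁻¹' {0}) := by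
    rw [inter_comm, hOe]
    exact hO.measurableSet.inter Metric.isOpen_ball.measurableSet
  refine Measure.addHaar_eq_zero_of_disjoint_translates volume
    (fun n : ℕ => ((n : ℝ) + 1)⁻¹ • e) ?_ ?_ hmeas
  · refine (Metric.isBounded_closedBall (x := (0 : E)) (r := ‖e‖)).subset ?_
    rintro _ ⟨n, rfl⟩
    rw [mem_closedBall_zero_iff, norm_smul, norm_inv,
      Real.norm_of_nonneg (by positivity : (0 : ℝ) ≤ (n : ℝ) + 1)]
    refine mul_le_of_le_one_left (norm_nonneg _) (inv_le_one_of_one_le₀ ?_)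
    linarith [n.cast_nonneg (α := ℝ)]
  · have main : ∀ s t : ℝ, s < t → Disjoint (({s • e} : Set E) + Metric.ball p r ∩ ρ ⁻¹' {0})
        (({t • e} : Set E) + Metric.ball p r ∩ ρ ⁻¹' {0}) := by
      intro s t hst
      rw [Set.disjoint_left]
      rintro x hx hx'
      rw [singleton_add] at hx hx'
      obtain ⟨a, ⟨ha, ha0⟩, rfl⟩ := hx
      obtain ⟨b, ⟨hb, hb0⟩, hab⟩ := hx'
      have hab' : a = b + (t - s) • e := by
        have : t • e + b = s • e + a := hab
        rw [sub_smul, ← add_right_inj (s • e), ← this]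
        abel
      have := lt_of_inner_gradient_pos (convex_ball p r) Metric.isOpen_ball hρB
        (fun x hx => (hball x hx).1) (sub_pos.2 hst) hb (hab' ▸ ha)
      rw [← hab'] at this
      simp only [mem_preimage, mem_singleton_iff] at ha0 hb0
      linarith
    intro i j hij
    rcases lt_or_gt_of_ne hij with hlt | hlt
    · exact (main _ _ (by gcongr)).symm
    · exact main _ _ (by gcongr)

/-- With the mean value theorem this controls `∫_P ⟪∇b, v⟫` for some translate of the bump `b` by
comparing the mass of `b` in `P` before and after sliding; it replaces the evaluation of a boundary
integral. -/
theorem hasDerivAt_setIntegral_translate {b : E → ℝ} (hb : ContDiff ℝ 1 b)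
    (hc : HasCompactSupport b) (P : Set E) (v : E) (s₀ : ℝ) :
    HasDerivAt (fun s : ℝ => ∫ x in P, b (x - s • v))
      (-∫ x in P, ⟪∇ b (x - s₀ • v), v⟫_ℝ) s₀ := by
  obtain ⟨R, hR⟩ := (hc : IsCompact (tsupport b)).isBounded.subset_closedBall 0
  obtain ⟨M, hM⟩ : ∃ M, ∀ x, ‖-⟪∇ b x, v⟫_ℝ‖ ≤ M := by
    refine Continuous.bounded_above_of_compact_support
      ((hb.continuous_gradient.inner continuous_const).neg)
      (HasCompactSupport.intro hc fun x hx => ?_)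
    simp [gradient_eq_zero_of_notMem_tsupport hx, -inner_gradient_left]
  rw [← integral_neg]
  have hcont : ∀ s : ℝ, Continuous fun x => b (x - s • v) := fun s =>
    hb.continuous.comp (continuous_id.sub continuous_const)
  have hbd : ∀ᵐ x ∂(volume.restrict P), ∀ s ∈ Metric.ball s₀ 1,
      ‖-⟪∇ b (x - s • v), v⟫_ℝ‖ ≤
        (Metric.closedBall (0 : E) (R + (|s₀| + 1) * ‖v‖)).indicator (fun _ => M) x := by
    refine .of_forall fun x s hs => ?_
    by_cases hx : x ∈ Metric.closedBall (0 : E) (R + (|s₀| + 1) * ‖v‖)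
    · rw [indicator_of_mem hx]
      exact hM _
    · rw [indicator_of_notMem hx, gradient_eq_zero_of_notMem_tsupport]
      · simp
      · intro hx'
        apply hx
        have h1 := hR hx'
        rw [mem_closedBall_zero_iff] at h1 ⊢
        have h2 : |s| ≤ |s₀| + 1 := by
          rw [Metric.mem_ball, Real.dist_eq] at hs
          have := abs_sub_abs_le_abs_sub s s₀
          linarith
        calc ‖x‖ = ‖(x - s • v) + s • v‖ := by rw [sub_add_cancel]
          _ ≤ ‖x - s • v‖ + ‖s • v‖ := norm_add_le _ _
          _ ≤ R + (|s₀| + 1) * ‖v‖ := by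
              rw [norm_smul, Real.norm_eq_abs]
              gcongr
  refine (hasDerivAt_integral_of_dominated_loc_of_deriv_le (𝕜 := ℝ)
    (Metric.ball_mem_nhds s₀ one_pos)
    (.of_forall fun s => (hcont s).aestronglyMeasurable) ?_ ?_ hbd ?_ ?_).2
  · refine Integrable.integrableOn ?_
    have := (hb.continuous.integrable_of_hasCompactSupport (μ := (volume : Measure E)) hc)
    exact this.comp_sub_right (s₀ • v)
  · exact (((hb.continuous_gradient.comp (continuous_id.sub continuous_const)).inner
      continuous_const).neg).aestronglyMeasurable
  · exact ((integrable_indicator_iff Metric.isClosed_closedBall.measurableSet).2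
      (integrableOn_const (isCompact_closedBall _ _).measure_lt_top.ne)).integrableOn
  · refine .of_forall fun x s _ => ?_
    have h1 : HasDerivAt (fun s : ℝ => x - s • v) (-v) s := by
      simpa using ((hasDerivAt_id s).smul_const v).const_sub x
    have := (hb.differentiable one_ne_zero (x - s • v)).hasFDerivAt.comp_hasDerivAt s h1
    rw [map_neg] at this
    rw [inner_gradient_eq]
    exact this

end LevelSets

/-! ### Normal components on the two sides of a level set. -/

section NormalTraces

/-- The shift by `1` makes the transition vanish wherever `ρ ≤ 1 / c`, which keeps the support away
from `{ρ = 0}`. -/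
theorem isC1Test_smoothTransition_mul {E : Type*} [NormedAddCommGroup E]
    [InnerProductSpace ℝ E] {V : Set E} {ρ φ : E → ℝ} (hV : IsOpen V)
    (hρ : ContDiffOn ℝ 1 ρ V) (hφ : IsC1Test V φ) {c : ℝ} (hc : 0 < c) :
    IsC1Test (V ∩ {x | 0 < ρ x}) (fun x => Real.smoothTransition (c * ρ x - 1) * φ x) := by
  have hts : tsupport (fun x => Real.smoothTransition (c * ρ x - 1) * φ x) ⊆ tsupport φ :=
    tsupport_mul_subset_right
  refine ⟨?_, hφ.compact.mul_left, fun x hx => ⟨hφ.supp (hts hx), ?_⟩⟩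
  · rw [contDiff_iff_contDiffAt]
    intro x
    by_cases hx : x ∈ tsupport φ
    · have h1 : ContDiffAt ℝ 1 ρ x := hρ.contDiffAt (hV.mem_nhds (hφ.supp hx))
      exact (Real.smoothTransition.contDiffAt.comp x
        ((contDiffAt_const.mul h1).sub contDiffAt_const)).mul hφ.contDiff.contDiffAt
    · refine (contDiffAt_const (c := (0 : ℝ))).congr_of_eventuallyEq ?_
      filter_upwards [notMem_tsupport_iff_eventuallyEq.1 hx] with y hy
      simp [hy]
  · by_contra hx'
    rw [mem_ofPred_eq, not_lt] at hx'
    refine notMem_tsupport_iff_eventuallyEq.2 ?_ hx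
    have h1 : ContinuousAt ρ x := hρ.continuousOn.continuousAt (hV.mem_nhds (hφ.supp (hts hx)))
    have h2 : ∀ᶠ y in 𝓝 x, ρ y < c⁻¹ :=
      h1.eventually_lt continuousAt_const (hx'.trans_lt (inv_pos.2 hc))
    filter_upwards [h2] with y hy
    rw [Real.smoothTransition.zero_of_nonpos, zero_mul, Pi.zero_apply]
    have := mul_lt_mul_of_pos_left hy hc
    rw [mul_inv_cancel₀ hc.ne'] at this
    linarith

variable {E : Type*} [NormedAddCommGroup E] [InnerProductSpace ℝ E] [FiniteDimensional ℝ E]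
  [MeasurableSpace E] [BorelSpace E]

/-- If the normal component of `X` along `{ρ = 0}` points into `{ρ > 0}`, the boundary term in
the divergence theorem on `{ρ > 0}` has a sign. -/
theorem HasWeakDivergence.setIntegral_nonpos {V : Set E} {ρ φ : E → ℝ} {X : E → E} {h : E → ℝ}
    (hV : IsOpen V) (hρ : ContDiffOn ℝ 1 ρ V) (hX : HasWeakDivergence (V ∩ {x | 0 < ρ x}) X h)
    (hXi : LocallyIntegrableOn X V volume) (hhi : LocallyIntegrableOn h V volume)
    (hφ : IsC1Test V φ) (hφ0 : ∀ x, 0 ≤ φ x)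
    (hpos : ∀ᵐ x, x ∈ tsupport φ → 0 < ρ x → 0 ≤ ⟪X x, ∇ ρ x⟫_ℝ) :
    ∫ x in V ∩ {x | 0 < ρ x}, (⟪X x, ∇ φ x⟫_ℝ + h x * φ x) ≤ 0 := by
  set P := V ∩ {x | 0 < ρ x} with hP
  have hPo : IsOpen P := hρ.continuousOn.isOpen_inter_preimage hV isOpen_Ioi
  set g : E → ℝ := fun x => ⟪X x, ∇ φ x⟫_ℝ + h x * φ x with hg
  have hgi : IntegrableOn g P volume := (hφ.integrable hXi hhi).integrableOn
  set τ : ℕ → E → ℝ := fun n x => Real.smoothTransition (((n : ℝ) + 1) * ρ x - 1) with hτ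
  have hτc : ∀ n, ContinuousOn (τ n) P := fun n =>
    Real.smoothTransition.continuous.comp_continuousOn
      ((continuousOn_const.mul (hρ.continuousOn.mono inter_subset_left)).sub continuousOn_const)
  have hτm : ∀ n, AEStronglyMeasurable (τ n) (volume.restrict P) := fun n =>
    (hτc n).aestronglyMeasurable hPo.measurableSet
  have hτ01 : ∀ n x, ‖τ n x‖ ≤ 1 := fun n x => by
    rw [Real.norm_of_nonneg (Real.smoothTransition.nonneg _)]
    exact Real.smoothTransition.le_one _
  have hτg : ∀ n, IntegrableOn (fun x => τ n x * g x) P volume := fun n =>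
    hgi.bdd_mul (hτm n) (.of_forall (hτ01 n))
  have hle : ∀ n, ∫ x in P, τ n x * g x ≤ 0 := by
    intro n
    have hn : (0 : ℝ) < (n : ℝ) + 1 := by positivity
    have htest := isC1Test_smoothTransition_mul hV hρ hφ hn
    rw [← hP] at htest
    have hint := (htest.mono (inter_subset_left : P ⊆ V)).integrable hXi hhi
    have hzero := hX _ htest
    rw [← setIntegral_eq_integral_of_forall_compl_eq_zero (s := P)] at hzero
    · rw [← hzero]
      refine setIntegral_mono_on_ae (hτg n) hint.integrableOn hPo.measurableSet ?_
      filter_upwards [hpos] with x hx hxP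
      by_cases hxφ : x ∈ tsupport φ
      · have hd : DifferentiableAt ℝ ρ x :=
          (hρ.differentiableOn one_ne_zero).differentiableAt (hV.mem_nhds hxP.1)
        have hs : Differentiable ℝ fun s : ℝ => Real.smoothTransition (((n : ℝ) + 1) * s - 1) :=
          (Real.smoothTransition.contDiff (n := 1)).differentiable one_ne_zero |>.comp
            (by fun_prop)
        have hmono : Monotone fun s : ℝ => Real.smoothTransition (((n : ℝ) + 1) * s - 1) :=
          fun s t hst => Real.smoothTransition.monotone (by gcongr)
        have hgr : ∇ (τ n) x = deriv (fun s : ℝ => Real.smoothTransition (((n : ℝ) + 1) * s - 1))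
            (ρ x) • ∇ ρ x := gradient_comp_apply (hs _) hd
        have hdτ : DifferentiableAt ℝ (τ n) x := (hs (ρ x)).comp x hd
        change _ ≤ ⟪X x, ∇ (fun x => τ n x * φ x) x⟫_ℝ + h x * (τ n x * φ x)
        rw [gradient_mul_apply hdτ (hφ.differentiableAt x), hgr, inner_add_right,
          real_inner_smul_right, real_inner_smul_right, real_inner_smul_right]
        -- The integrand for `τ n * φ` exceeds `τ n * g` by `φ` times the derivative of the
        -- transition times `⟪X, ∇ρ⟫`, and all three factors are nonnegative.
        have := mul_nonneg (hφ0 x) (mul_nonneg (hmono.deriv_nonneg (x := ρ x)) (hx hxφ hxP.2))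
        simp only [hg]
        linarith
      · have h1 : x ∉ tsupport (fun x => Real.smoothTransition (((n : ℝ) + 1) * ρ x - 1) * φ x) :=
          fun h' => hxφ (tsupport_mul_subset_right h')
        simp only [hg]
        rw [gradient_eq_zero_of_notMem_tsupport h1, gradient_eq_zero_of_notMem_tsupport hxφ,
          image_eq_zero_of_notMem_tsupport hxφ]
        simp
    · intro x hx
      have h1 := htest.eq_zero hx
      have h2 := htest.gradient_eq_zero hx
      rw [h1, h2]
      simp
  have hlim : Tendsto (fun n => ∫ x in P, τ n x * g x) atTop (𝓝 (∫ x in P, g x)) := by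
    refine tendsto_integral_of_dominated_convergence (fun x => ‖g x‖)
      (fun n => (hτg n).aestronglyMeasurable) hgi.norm (fun n => .of_forall fun x => ?_) ?_
    · rw [norm_mul]
      exact mul_le_of_le_one_left (norm_nonneg _) (hτ01 n x)
    · filter_upwards [ae_restrict_mem hPo.measurableSet] with x hx
      refine tendsto_const_nhds.congr' ?_
      have hx0 : 0 < ρ x := hx.2
      filter_upwards [eventually_ge_atTop ⌈2 / ρ x⌉₊] with n hn
      have h1 : 2 / ρ x ≤ n := (Nat.le_ceil _).trans (by exact_mod_cast hn)
      rw [div_le_iff₀ hx0] at h1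
      simp only [hτ]
      rw [Real.smoothTransition.one_of_one_le (by nlinarith), one_mul]
  exact le_of_tendsto' hlim hle

/-- Apply `setIntegral_nonpos` to `X - (k - δ) • e` on `{ρ > 0}` and to `X - (k + δ) • e` on `{ρ <
0}` with `-ρ`, then add. The field `k • e` contributes zero because its divergence is classical
across `{ρ = 0}`, and the two `δ` terms coincide since `∫ ⟪∇φ, e⟫ = 0`. The sign of `δ` is free:
positive when the traces match, negative when they jump. -/
theorem HasWeakDivergence.integral_le_of_normal_bounds {V : Set E} {ρ φ k : E → ℝ} {X : E → E}
    {h : E → ℝ} {e : E} {δ : ℝ} (hV : IsOpen V) (hρ : ContDiffOn ℝ 1 ρ V)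
    (he : ∀ x ∈ V, ∇ ρ x ≠ 0) (hX : HasWeakDivergence (V ∩ {x | ρ x ≠ 0}) X h)
    (hXi : LocallyIntegrableOn X V volume) (hhi : LocallyIntegrableOn h V volume)
    (hk : ContDiff ℝ 1 k) (hφ : IsC1Test V φ) (hφ0 : ∀ x, 0 ≤ φ x)
    (hp : ∀ᵐ x, x ∈ tsupport φ → 0 < ρ x → (k x - δ) * ⟪∇ ρ x, e⟫_ℝ ≤ ⟪X x, ∇ ρ x⟫_ℝ)
    (hn : ∀ᵐ x, x ∈ tsupport φ → ρ x < 0 → ⟪X x, ∇ ρ x⟫_ℝ ≤ (k x + δ) * ⟪∇ ρ x, e⟫_ℝ) :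
    ∫ x, (⟪X x, ∇ φ x⟫_ℝ + h x * φ x) ≤
      -(2 * δ) * ∫ x in V ∩ {x | 0 < ρ x}, ⟪∇ φ x, e⟫_ℝ := by
  set P := V ∩ {x | 0 < ρ x} with hP
  set Q := V ∩ {x | 0 < -ρ x} with hQ
  have hPo : IsOpen P := hρ.continuousOn.isOpen_inter_preimage hV isOpen_Ioi
  have hQo : IsOpen Q := hρ.neg.continuousOn.isOpen_inter_preimage hV isOpen_Ioi
  have hPQ : Disjoint P Q := by
    rw [Set.disjoint_left]
    rintro x ⟨-, h1⟩ ⟨-, h2⟩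
    simp only [mem_ofPred_eq] at h1 h2
    linarith
  have hcover : ∀ f : E → ℝ, Integrable f → (∀ x ∉ V, f x = 0) →
      ∫ x, f x = (∫ x in P, f x) + ∫ x in Q, f x := by
    intro f hf hf0
    rw [← setIntegral_union hPQ hQo.measurableSet hf.integrableOn hf.integrableOn,
      ← setIntegral_eq_integral_of_forall_compl_eq_zero hf0]
    refine setIntegral_congr_set ?_
    have hnull := volume_zero_set_eq_zero hV hρ he
    have hdiff : V \ (P ∪ Q) ⊆ {x ∈ V | ρ x = 0} := by
      intro x hx
      refine ⟨hx.1, ?_⟩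
      rcases lt_trichotomy (ρ x) 0 with h1 | h1 | h1
      · exact absurd (Or.inr ⟨hx.1, neg_pos.2 h1⟩) hx.2
      · exact h1
      · exact absurd (Or.inl ⟨hx.1, h1⟩) hx.2
    refine ae_eq_set.2 ⟨measure_mono_null hdiff hnull, ?_⟩
    rw [sdiff_eq_empty.2 (union_subset inter_subset_left inter_subset_left), measure_empty]
  have hci : ∀ c : E → ℝ, Continuous c → LocallyIntegrableOn (fun x => c x • e) V volume :=
    fun c hc => (hc.smul continuous_const).locallyIntegrable.locallyIntegrableOn _
  have hgki : LocallyIntegrableOn (fun x => ⟪∇ k x, e⟫_ℝ) V volume :=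
    (hk.continuous_gradient.inner continuous_const).locallyIntegrable.locallyIntegrableOn _
  have hgk : ∀ c : ℝ, ∀ x, ∇ (fun x => k x + c) x = ∇ k x := by
    intro c x
    rw [gradient_add_apply (hk.differentiable one_ne_zero x) (differentiableAt_const _),
      gradient_fun_const, add_zero]
  have hkc : ∀ c : ℝ, ContDiff ℝ 1 fun x => k x + c := fun c => hk.add contDiff_const
  have hdiv : ∀ (c : ℝ) (W : Set E), HasWeakDivergence W (fun x => (k x + c) • e)
      (fun x => ⟪∇ k x, e⟫_ℝ) := by
    intro c W
    simpa only [hgk] using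
      (hasWeakDivergence_smul_const isOpen_univ (hkc c).contDiffOn e).mono (subset_univ W)
  have hsub : ∀ (c : ℝ) (W : Set E), W ⊆ V ∩ {x | ρ x ≠ 0} →
      HasWeakDivergence W (fun x => X x - (k x + c) • e) (fun x => h x - ⟪∇ k x, e⟫_ℝ) := by
    intro c W hW
    have hWV : W ⊆ V := hW.trans inter_subset_left
    exact (hX.mono hW).sub (hdiv c W) (hXi.mono_set hWV) (hhi.mono_set hWV)
      ((hci _ (hkc c).continuous).mono_set hWV) (hgki.mono_set hWV)
  have hsubi : ∀ c : ℝ, LocallyIntegrableOn (fun x => X x - (k x + c) • e) V volume :=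
    fun c => hXi.sub (hci _ (hkc c).continuous)
  have hpos := (hsub (-δ) P fun x hx => ⟨hx.1, (show (0 : ℝ) < ρ x from hx.2).ne'⟩).setIntegral_nonpos
    hV hρ (hsubi _) (hhi.sub hgki) hφ hφ0 (by
      filter_upwards [hp] with x hx h1 h2
      rw [inner_sub_left, real_inner_smul_left, real_inner_comm (∇ ρ x) e]
      linarith [hx h1 h2])
  have hneg := (hsub δ Q fun x hx => ⟨hx.1, by
      have : (0 : ℝ) < -ρ x := hx.2
      simp only [mem_ofPred_eq]
      exact (neg_pos.1 this).ne⟩).setIntegral_nonpos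
    hV hρ.neg (hsubi _) (hhi.sub hgki) hφ hφ0 (by
      filter_upwards [hn] with x hx h1 h2
      have h3 : ∇ (fun x => -ρ x) x = -∇ ρ x := gradient_neg_apply ρ x
      have h4 : ρ x < 0 := by simpa using h2
      rw [h3, inner_neg_right, inner_sub_left, real_inner_smul_left, real_inner_comm (∇ ρ x) e]
      linarith [hx h1 h4])
  have hg := hφ.integrable hXi hhi
  have hq := hφ.integrable (hci _ hk.continuous) hgki
  have hd := integrable_inner_gradient hφ.contDiff hφ.compact e
  have hT := hcover _ hg fun x hx => by simp [hφ.eq_zero hx, hφ.gradient_eq_zero hx]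
  have hq0 := hcover _ hq fun x hx => by simp [hφ.eq_zero hx, hφ.gradient_eq_zero hx]
  have hd0 := hcover _ hd fun x hx => by simp [hφ.gradient_eq_zero hx]
  rw [integral_inner_gradient_eq_zero hφ.contDiff hφ.compact] at hd0
  have hq1 : ∫ x, (⟪k x • e, ∇ φ x⟫_ℝ + ⟪∇ k x, e⟫_ℝ * φ x) = 0 :=
    hasWeakDivergence_smul_const hV hk.contDiffOn e φ hφ
  rw [hq1] at hq0
  have hsplit : ∀ (c : ℝ) (S : Set E),
      ∫ x in S, (⟪X x - (k x + c) • e, ∇ φ x⟫_ℝ + (h x - ⟪∇ k x, e⟫_ℝ) * φ x) =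
      (∫ x in S, (⟪X x, ∇ φ x⟫_ℝ + h x * φ x)) -
        (∫ x in S, (⟪k x • e, ∇ φ x⟫_ℝ + ⟪∇ k x, e⟫_ℝ * φ x)) -
        c * ∫ x in S, ⟪∇ φ x, e⟫_ℝ := by
    intro c S
    rw [← integral_const_mul, ← integral_sub hg.integrableOn hq.integrableOn]
    refine Eq.trans ?_ (integral_sub (hg.integrableOn.sub hq.integrableOn)
      (hd.integrableOn.const_mul c))
    congr 1
    ext x
    rw [inner_sub_left, real_inner_smul_left, real_inner_smul_left, real_inner_comm (∇ φ x) e]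
    ring
  rw [hsplit] at hpos hneg
  rw [hT]
  have e1 : ∫ x in Q, ⟪∇ φ x, e⟫_ℝ = -∫ x in P, ⟪∇ φ x, e⟫_ℝ := by linarith
  rw [e1] at hneg
  linarith

/-- For each `δ > 0` the constant `L / ⟪∇ρ(p), e⟫` satisfies the required bounds near `p`. These
bounds are convex conditions on the value of `k`, so a partition of unity glues the constants into
one `C¹` function `k`; then `δ → 0`. -/
theorem HasWeakDivergence.integral_nonpos_of_normal_limits {V : Set E} {ρ φ : E → ℝ} {X : E → E}
    {h : E → ℝ} {e : E} (hV : IsOpen V) (hρ : ContDiffOn ℝ 1 ρ V)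
    (he : ∀ x ∈ V, 0 < ⟪∇ ρ x, e⟫_ℝ) (hX : HasWeakDivergence (V ∩ {x | ρ x ≠ 0}) X h)
    (hXi : LocallyIntegrableOn X V volume) (hhi : LocallyIntegrableOn h V volume)
    (hlim : ∀ p ∈ V, ∃ L, Tendsto (fun x => ⟪X x, ∇ ρ x⟫_ℝ) (𝓝[V ∩ {x | ρ x ≠ 0}] p) (𝓝 L))
    (hφ : IsC1Test V φ) (hφ0 : ∀ x, 0 ≤ φ x) :
    ∫ x, (⟪X x, ∇ φ x⟫_ℝ + h x * φ x) ≤ 0 := by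
  set I := ∫ x in V ∩ {x | 0 < ρ x}, ⟪∇ φ x, e⟫_ℝ with hI
  have key : ∀ δ : ℝ, 0 < δ → ∫ x, (⟪X x, ∇ φ x⟫_ℝ + h x * φ x) ≤ -(2 * δ) * I := by
    intro δ hδ
    let t : E → Set ℝ := fun x => {c | x ∈ tsupport φ → ρ x ≠ 0 →
      (c - δ) * ⟪∇ ρ x, e⟫_ℝ ≤ ⟪X x, ∇ ρ x⟫_ℝ ∧ ⟪X x, ∇ ρ x⟫_ℝ ≤ (c + δ) * ⟪∇ ρ x, e⟫_ℝ}
    have hconv : ∀ x, Convex ℝ (t x) := by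
      intro x a ha b hb α β hα hβ hαβ hx hx0
      obtain ⟨a1, a2⟩ := ha hx hx0
      obtain ⟨b1, b2⟩ := hb hx hx0
      have hβ' : β = 1 - α := by linarith
      subst hβ'
      simp only [smul_eq_mul]
      constructor <;> nlinarith
    have hloc : ∀ x, ∃ c : ℝ, ∀ᶠ y in 𝓝 x, c ∈ t y := by
      intro p
      by_cases hp : p ∈ tsupport φ
      · have hpV := hφ.supp hp
        obtain ⟨L, hL⟩ := hlim p hpV
        have hgc : ContinuousAt (fun x => ⟪∇ ρ x, e⟫_ℝ) p :=
          ((hρ.continuousOn_gradient hV).inner continuousOn_const).continuousAt (hV.mem_nhds hpV)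
        have hpos := he p hpV
        refine ⟨L / ⟪∇ ρ p, e⟫_ℝ, ?_⟩
        have hg1 : Tendsto (fun x => (L / ⟪∇ ρ p, e⟫_ℝ - δ) * ⟪∇ ρ x, e⟫_ℝ)
            (𝓝[V ∩ {x | ρ x ≠ 0}] p) (𝓝 ((L / ⟪∇ ρ p, e⟫_ℝ - δ) * ⟪∇ ρ p, e⟫_ℝ)) :=
          (hgc.tendsto.mono_left nhdsWithin_le_nhds).const_mul _
        have hg2 : Tendsto (fun x => (L / ⟪∇ ρ p, e⟫_ℝ + δ) * ⟪∇ ρ x, e⟫_ℝ)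
            (𝓝[V ∩ {x | ρ x ≠ 0}] p) (𝓝 ((L / ⟪∇ ρ p, e⟫_ℝ + δ) * ⟪∇ ρ p, e⟫_ℝ)) :=
          (hgc.tendsto.mono_left nhdsWithin_le_nhds).const_mul _
        have e1 := hg1.eventually_lt hL (by
          rw [sub_mul, div_mul_cancel₀ _ hpos.ne']
          nlinarith)
        have e2 := hL.eventually_lt hg2 (by
          rw [add_mul, div_mul_cancel₀ _ hpos.ne']
          nlinarith)
        filter_upwards [eventually_nhdsWithin_iff.1 (e1.and e2), hV.mem_nhds hpV] with y hy hyV _ hy0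
        exact ⟨(hy ⟨hyV, hy0⟩).1.le, (hy ⟨hyV, hy0⟩).2.le⟩
      -- Off the support of `φ` the condition is void, so any value serves.
      · refine ⟨0, ?_⟩
        filter_upwards [(isClosed_tsupport φ).isOpen_compl.mem_nhds hp] with y hy hy'
        exact absurd hy' hy
    obtain ⟨k, hk⟩ := exists_contMDiffMap_forall_mem_convex_of_local_const (n := 1)
      (modelWithCornersSelf ℝ E) hconv hloc
    refine hX.integral_le_of_normal_bounds (k := k) hV hρ (fun x hx h0 => ?_) hXi hhi
      k.contMDiff.contDiff hφ hφ0 (.of_forall fun x h1 h2 => (hk x h1 h2.ne').1)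
      (.of_forall fun x h1 h2 => (hk x h1 h2.ne).2)
    have := he x hx
    rw [h0, inner_zero_left] at this
    exact this.ne rfl
  have hlim0 : Tendsto (fun δ : ℝ => -(2 * δ) * I) (𝓝[>] 0) (𝓝 0) := by
    have : Tendsto (fun δ : ℝ => -(2 * δ) * I) (𝓝 0) (𝓝 (-(2 * 0) * I)) :=
      (by fun_prop : Continuous fun δ : ℝ => -(2 * δ) * I).tendsto 0
    simp only [mul_zero, neg_zero, zero_mul] at this
    exact this.mono_left nhdsWithin_le_nhds
  exact ge_of_tendsto hlim0 (by filter_upwards [self_mem_nhdsWithin] with δ hδ using key δ hδ)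

/-- A field with a weak divergence off `{ρ = 0}`, whose normal component extends continuously
across `{ρ = 0}`, has this weak divergence across `{ρ = 0}`. -/
theorem HasWeakDivergence.of_normal_limits {V : Set E} {ρ : E → ℝ} {X : E → E}
    {h : E → ℝ} {e : E} (hV : IsOpen V) (hρ : ContDiffOn ℝ 1 ρ V)
    (he : ∀ x ∈ V, 0 < ⟪∇ ρ x, e⟫_ℝ) (hX : HasWeakDivergence (V ∩ {x | ρ x ≠ 0}) X h)
    (hXi : LocallyIntegrableOn X V volume) (hhi : LocallyIntegrableOn h V volume)
    (hlim : ∀ p ∈ V, ∃ L, Tendsto (fun x => ⟪X x, ∇ ρ x⟫_ℝ) (𝓝[V ∩ {x | ρ x ≠ 0}] p) (𝓝 L)) :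
    HasWeakDivergence V X h := by
  have hnonneg : ∀ φ, IsC1Test V φ → (∀ x, 0 ≤ φ x) →
      ∫ x, (⟪X x, ∇ φ x⟫_ℝ + h x * φ x) = 0 := by
    intro φ hφ hφ0
    refine le_antisymm (hX.integral_nonpos_of_normal_limits hV hρ he hXi hhi hlim hφ hφ0) ?_
    have := hX.neg.integral_nonpos_of_normal_limits hV hρ he hXi.neg hhi.neg (fun p hp => by
      obtain ⟨L, hL⟩ := hlim p hp
      exact ⟨-L, by simpa only [inner_neg_left] using hL.neg⟩) hφ hφ0
    rw [← neg_nonneg, ← integral_neg] at this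
    refine this.trans_eq ?_
    congr 1
    ext x
    rw [inner_neg_left]
    ring
  intro φ hφ
  -- A general `φ` is the difference of the nonnegative test functions `φ + M η` and `M η`, where
  -- `M` bounds `|φ|` and `η = 1` on its support.
  obtain ⟨η, hη, hη01, hηc, hηV, hη1⟩ := exists_contDiff_cutoff hφ.compact hV hφ.supp
  obtain ⟨M, hM⟩ : ∃ M, ∀ x, ‖φ x‖ ≤ M :=
    hφ.contDiff.continuous.bounded_above_of_compact_support hφ.compact
  have hM0 : 0 ≤ M := (norm_nonneg _).trans (hM 0)
  have t1 : IsC1Test V (fun x => M * η x) :=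
    (⟨hη, hηc, hηV⟩ : IsC1Test V η).mul_left contDiff_const
  have t2 := hφ.add t1
  have n1 := hnonneg _ t1 fun x => mul_nonneg hM0 (hη01 x).1
  have n2 := hnonneg _ t2 fun x => by
    by_cases hx : x ∈ tsupport φ
    · rw [(hη1 x hx).self_of_nhds, mul_one]
      linarith [(abs_le.1 (hM x)).1]
    · rw [image_eq_zero_of_notMem_tsupport hx, zero_add]
      exact mul_nonneg hM0 (hη01 x).1
  have e1 := integral_sub (t2.integrable hXi hhi) (t1.integrable hXi hhi)
  rw [n1, n2, sub_zero] at e1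
  rw [← e1]
  congr 1
  ext x
  rw [gradient_add_apply (hφ.differentiableAt x) (t1.differentiableAt x), inner_add_right]
  ring

/-- A substitute for graph coordinates: `ρ` has strict signs at `p + s • e` and `p - s • e`, and by
continuity the same shifts carry a whole small ball to one side. -/
theorem exists_shift_of_inner_gradient_pos {E : Type*} [NormedAddCommGroup E]
    [InnerProductSpace ℝ E] [CompleteSpace E] {ρ : E → ℝ} {e p : E} {r : ℝ}
    (hr : 0 < r) (hρ : ContDiffOn ℝ 1 ρ (Metric.ball p r))
    (he : ∀ x ∈ Metric.ball p r, 0 < ⟪∇ ρ x, e⟫_ℝ) (hp0 : ρ p = 0) :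
    ∃ s > 0, ∃ r' > 0, (∀ x ∈ Metric.ball p r', ∀ t : ℝ, |t| ≤ s → x + t • e ∈ Metric.ball p r) ∧
      (∀ x ∈ Metric.ball p r', 0 < ρ (x + s • e)) ∧
      ∀ x ∈ Metric.ball p r', ρ (x - s • e) < 0 := by
  have hpB : p ∈ Metric.ball p r := Metric.mem_ball_self hr
  set s : ℝ := r / (2 * (‖e‖ + 1)) with hs
  have hs0 : 0 < s := by positivity
  have hse : s * ‖e‖ < r / 2 := by
    rw [hs, div_mul_eq_mul_div, div_lt_div_iff₀ (by positivity) two_pos]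
    nlinarith [norm_nonneg e]
  have hmem : ∀ x ∈ Metric.ball p (r / 2), ∀ t : ℝ, |t| ≤ s → x + t • e ∈ Metric.ball p r := by
    intro x hx t ht
    rw [Metric.mem_ball, dist_eq_norm] at hx ⊢
    calc ‖x + t • e - p‖ = ‖(x - p) + t • e‖ := by congr 1; abel
      _ ≤ ‖x - p‖ + ‖t • e‖ := norm_add_le _ _
      _ < r / 2 + r / 2 := by
          refine add_lt_add hx ?_
          rw [norm_smul, Real.norm_eq_abs]
          exact (mul_le_mul_of_nonneg_right ht (norm_nonneg e)).trans_lt hse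
      _ = r := add_halves r
  have hp' : p ∈ Metric.ball p (r / 2) := Metric.mem_ball_self (by positivity)
  have hm1 : p + s • e ∈ Metric.ball p r := hmem p hp' s (abs_of_pos hs0).le
  have hm2 : p + (-s) • e ∈ Metric.ball p r := hmem p hp' (-s) (by rw [abs_neg, abs_of_pos hs0])
  have hup : 0 < ρ (p + s • e) := hp0 ▸
    lt_of_inner_gradient_pos (convex_ball p r) Metric.isOpen_ball hρ he hs0 hpB hm1
  have hdown : ρ (p + (-s) • e) < 0 := by
    have e1 : p + (-s) • e + s • e = p := by simp
    have := lt_of_inner_gradient_pos (convex_ball p r) Metric.isOpen_ball hρ he hs0 hm2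
      (by rwa [e1])
    rwa [e1, hp0] at this
  have hcont : ∀ t : ℝ, p + t • e ∈ Metric.ball p r → ContinuousAt (fun x => ρ (x + t • e)) p :=
    fun t ht => ContinuousAt.comp (f := fun x => x + t • e)
      (hρ.continuousOn.continuousAt (Metric.isOpen_ball.mem_nhds ht)) (by fun_prop)
  obtain ⟨r', hr', hball⟩ := Metric.eventually_nhds_iff_ball.1
    (((hcont _ hm1).eventually_const_lt hup).and
      (((hcont _ hm2).eventually_lt_const hdown).and (Metric.ball_mem_nhds p (half_pos hr))))
  refine ⟨s, hs0, r', hr', fun x hx => hmem x (hball x hx).2.2, fun x hx => (hball x hx).1,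
    fun x hx => ?_⟩
  have := (hball x hx).2.1
  rwa [neg_smul, ← sub_eq_add_neg] at this

/-- If the normal component of `X` jumps up across `{ρ = 0}` at `p`, then `X` has no locally
integrable weak divergence near `p` with the given density. -/
theorem exists_test_integral_neg_of_jump {V : Set E} {ρ : E → ℝ} {X : E → E} {h : E → ℝ} {e p : E}
    {a δ : ℝ} (hV : IsOpen V) (hρ : ContDiffOn ℝ 1 ρ V) (he : ∀ x ∈ V, 0 < ⟪∇ ρ x, e⟫_ℝ)
    (hX : HasWeakDivergence (V ∩ {x | ρ x ≠ 0}) X h)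
    (hXi : LocallyIntegrableOn X V volume) (hhi : LocallyIntegrableOn h V volume)
    (hp : p ∈ V) (hp0 : ρ p = 0) (hδ : 0 < δ)
    (hpos : ∀ᵐ x, x ∈ V → 0 < ρ x → (a + δ) * ⟪∇ ρ x, e⟫_ℝ ≤ ⟪X x, ∇ ρ x⟫_ℝ)
    (hneg : ∀ᵐ x, x ∈ V → ρ x < 0 → ⟪X x, ∇ ρ x⟫_ℝ ≤ (a - δ) * ⟪∇ ρ x, e⟫_ℝ) :
    ∃ φ : E → ℝ, ContDiff ℝ ∞ φ ∧ IsC1Test V φ ∧ ∫ x, (⟪X x, ∇ φ x⟫_ℝ + h x * φ x) < 0 := by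
  obtain ⟨r, hr, hball⟩ := Metric.isOpen_iff.1 hV p hp
  obtain ⟨s, hs0, r', hr', hmem, hup, hdown⟩ := exists_shift_of_inner_gradient_pos hr
    (hρ.mono hball) (fun x hx => he x (hball hx)) hp0
  obtain ⟨b, hbs, hbc, hb, hb01, hbp⟩ := exists_contDiff_tsupport_subset (n := ⊤)
    (Metric.ball_mem_nhds p hr')
  have hb0 : ∀ x, 0 ≤ b x := fun x => (hb01 (mem_range_self x)).1
  have hb1 : ContDiff ℝ 1 b := hb.of_le (by exact_mod_cast le_top)
  set P := V ∩ {x | 0 < ρ x} with hP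
  -- The mass in `P` of the bump sliding along `e`: zero at `t = -1`, full at `t = 1`. At an
  -- intermediate `c` its derivative is positive, so the translate `φ` by `c` has `∫_P ⟪∇φ, e⟫ < 0`.
  set g : ℝ → ℝ := fun t => ∫ x in P, b (x - t • (s • e)) with hg
  have hg1 : 0 < g 1 := by
    have h1 : g 1 = ∫ x, b (x - (1 : ℝ) • (s • e)) := by
      refine setIntegral_eq_integral_of_forall_compl_eq_zero fun x hx => ?_
      by_contra hbx
      have := hbs (subset_tsupport _ hbx)
      apply hx
      have e1 : x - (1 : ℝ) • s • e + s • e = x := by simp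
      have h1 := hmem _ this s (abs_of_pos hs0).le
      have h2 := hup _ this
      rw [e1] at h1 h2
      exact ⟨hball h1, h2⟩
    rw [h1, integral_sub_right_eq_self (fun x => b x)]
    exact hb.continuous.integral_pos_of_hasCompactSupport_nonneg_nonzero hbc hb0
      (x := p) (by rw [hbp]; exact one_ne_zero)
  have hg0 : g (-1) = 0 := by
    refine setIntegral_eq_zero_of_forall_eq_zero fun x hx => ?_
    by_contra hbx
    have := hbs (subset_tsupport _ hbx)
    have e1 : x - (-1 : ℝ) • s • e - s • e = x := by simp
    have h2 := hdown _ this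
    rw [e1] at h2
    have h3 : 0 < ρ x := hx.2
    linarith
  have hgd := hasDerivAt_setIntegral_translate hb1 hbc P (s • e)
  obtain ⟨c, hc, hc'⟩ := exists_hasDerivAt_eq_slope g _ (show (-1 : ℝ) < 1 by norm_num)
    (fun t _ => (hgd t).continuousAt.continuousWithinAt) (fun t _ => hgd t)
  have hcpos : 0 < -∫ x in P, ⟪∇ b (x - c • (s • e)), s • e⟫_ℝ := by
    rw [hc', hg0]
    exact div_pos (by linarith) (by norm_num)
  have hcabs : |c| ≤ 1 := abs_le.2 ⟨hc.1.le, hc.2.le⟩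
  set φ : E → ℝ := fun x => b (x + -(c • (s • e))) with hφ
  have hφs : ContDiff ℝ ∞ φ := hb.comp (by fun_prop)
  have hφt : IsC1Test V φ := by
    refine ⟨hφs.of_le (by exact_mod_cast le_top), ?_, ?_⟩
    · exact hbc.comp_homeomorph (Homeomorph.addRight (-(c • (s • e))))
    · intro x hx
      have h1 : x + -(c • (s • e)) ∈ tsupport b := by
        have := tsupport_comp_subset_preimage b (f := fun x => x + -(c • (s • e))) (by fun_prop) hx
        exact this
      have h2 := hball (hmem _ (hbs h1) (c * s) (by
        rw [abs_mul, abs_of_pos hs0]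
        exact mul_le_of_le_one_left hs0.le hcabs))
      simpa [smul_smul] using h2
  have hgrad : ∀ x, ∇ φ x = ∇ b (x - c • (s • e)) := by
    intro x
    rw [sub_eq_add_neg]
    exact gradient_comp_add_right_apply b _ x
  refine ⟨φ, hφs, hφt, ?_⟩
  -- With parameter `-δ` the upper bound becomes `2δ ∫_P ⟪∇φ, e⟫`, which is negative.
  have hmain := hX.integral_le_of_normal_bounds (k := fun _ => a) (δ := -δ) (e := e) hV hρ
    (fun x hx h0 => by
      have := he x hx
      rw [h0, inner_zero_left] at this
      exact this.ne rfl) hXi hhi contDiff_const hφt (fun x => hb0 _)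
    (by
      filter_upwards [hpos] with x hx h1 h2
      simpa using hx (hφt.supp h1) h2)
    (by
      filter_upwards [hneg] with x hx h1 h2
      simpa [sub_eq_add_neg] using hx (hφt.supp h1) h2)
  refine hmain.trans_lt ?_
  simp only [real_inner_smul_right, integral_const_mul] at hcpos
  simp only [hgrad]
  rw [← hP]
  nlinarith [mul_pos hδ (pos_of_mul_pos_right (by linarith [hcpos] :
    0 < s * -∫ x in P, ⟪∇ b (x - c • (s • e)), e⟫_ℝ) hs0.le)]

end NormalTraces

/-! ### Sets of zero codimension-one measure do not disconnect. -/

section Connectedness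

variable {E : Type*} [NormedAddCommGroup E] [InnerProductSpace ℝ E] [FiniteDimensional ℝ E]
  [MeasurableSpace E] [BorelSpace E]

theorem volume_eq_zero_of_hausdorffMeasure_eq_zero {C : Set E}
    (h0 : Measure.hausdorffMeasure ((Module.finrank ℝ E : ℝ) - 1) C = 0) : volume C = 0 := by
  have h1 : Measure.hausdorffMeasure (Module.finrank ℝ E : ℝ) C = 0 :=
    le_antisymm ((Measure.hausdorffMeasure_mono (by linarith) C).trans_eq h0) zero_le
  exact Measure.absolutelyContinuous_isAddHaarMeasure (volume : Measure E)
    (Measure.hausdorffMeasure (Module.finrank ℝ E : ℝ)) h1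

theorem IsOpen.nonempty_diff_of_volume_eq_zero {U C : Set E} (hU : IsOpen U) (hne : U.Nonempty)
    (hC : volume C = 0) : (U \ C).Nonempty := by
  by_contra h
  rw [not_nonempty_iff_eq_empty, sdiff_eq_empty] at h
  exact (hU.measure_pos volume hne).ne' (measure_mono_null h hC)

/-- If `B \ C` split into open pieces `D ∋ x` and `D' ∋ y`, the field equal to `w = y - x` on `D`
and `0` elsewhere would be divergence free off `C`, hence in `B` by removability. Then the mass in
`D` of a bump sliding from `x` to `y` could not change, although it is positive at the start and
zero at the end. Convexity keeps the sliding bump inside `B`. -/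
theorem Convex.isPreconnected_diff_of_hausdorffMeasure_eq_zero (hd : 1 ≤ Module.finrank ℝ E)
    {B C : Set E} (hB : Convex ℝ B) (hBo : IsOpen B) (hC : IsClosed C)
    (h0 : Measure.hausdorffMeasure ((Module.finrank ℝ E : ℝ) - 1) C = 0) :
    IsPreconnected (B \ C) := by
  rw [isPreconnected_iff_subset_of_disjoint]
  intro u v hu hv hcov hdis
  by_contra hcon
  rw [not_or, not_subset, not_subset] at hcon
  obtain ⟨⟨x, hxs, hxu⟩, ⟨y, hys, hyv⟩⟩ := hcon
  have hso : IsOpen (B \ C) := hBo.sdiff hC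
  set D := (B \ C) ∩ v with hD
  set D' := (B \ C) ∩ u with hD'
  have hDo : IsOpen D := hso.inter hv
  have hDo' : IsOpen D' := hso.inter hu
  have hDD : Disjoint D D' := by
    rw [Set.disjoint_left]
    intro z hz hz'
    exact notMem_empty z (hdis ▸ ⟨hz.1, hz'.2, hz.2⟩)
  have hxD : x ∈ D := ⟨hxs, (hcov hxs).resolve_left hxu⟩
  have hyD : y ∈ D' := ⟨hys, (hcov hys).resolve_right hyv⟩
  set w : E := y - x with hw
  set X : E → E := D.indicator fun _ => w with hXdef
  have hXi : LocallyIntegrableOn X B volume := by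
    have h1 : LocallyIntegrable (fun _ : E => w) volume := locallyIntegrable_const w
    have h2 : LocallyIntegrable X volume := h1.indicator hDo.measurableSet
    exact h2.locallyIntegrableOn _
  have hhi : LocallyIntegrableOn (fun _ : E => (0 : ℝ)) B volume :=
    (locallyIntegrable_const (0 : ℝ)).locallyIntegrableOn _
  have hweak : HasWeakDivergence B X (fun _ => 0) := by
    refine HasWeakDivergence.of_diff hd (B := ‖w‖) hC h0 ?_ hXi hhi fun z => norm_indicator_le_norm_self _ _
    refine HasWeakDivergence.of_locally (hXi.mono_set sdiff_subset) (hhi.mono_set sdiff_subset) ?_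
    intro z hz
    rcases hcov hz with hzu | hzv
    · refine ⟨D', hDo', ⟨hz, hzu⟩, inter_subset_left, fun φ hφ => ?_⟩
      refine integral_eq_zero_of_ae (.of_forall fun t => ?_)
      by_cases ht : t ∈ D'
      · have : t ∉ D := fun h => Set.disjoint_left.1 hDD h ht
        simp [hXdef, this]
      · simp [hφ.gradient_eq_zero ht]
    · refine ⟨D, hDo, ⟨hz, hzv⟩, inter_subset_left, fun φ hφ => ?_⟩
      refine Eq.trans ?_ (integral_inner_gradient_eq_zero hφ.contDiff hφ.compact w)
      congr 1
      ext t
      by_cases ht : t ∈ D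
      · simp only [hXdef, indicator_of_mem ht]
        rw [real_inner_comm]
        ring
      · simp [hφ.gradient_eq_zero ht, -inner_gradient_left]
  obtain ⟨b, hbs, hbc, hb, hb01, hbx⟩ := exists_contDiff_tsupport_subset (n := 1) (x := x)
    (inter_mem (hDo.mem_nhds hxD)
      ((by fun_prop : Continuous fun z : E => z + w).continuousAt.preimage_mem_nhds
        (hDo'.mem_nhds (by simpa [hw] using hyD))))
  have hb0 : ∀ x, 0 ≤ b x := fun x => (hb01 (mem_range_self x)).1
  have hb1 : ContDiff ℝ 1 b := hb
  set g : ℝ → ℝ := fun t => ∫ z in D, b (z - t • w) with hg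
  have hgd := hasDerivAt_setIntegral_translate hb1 hbc D w
  have hder : ∀ t ∈ Ioo (0 : ℝ) 1, -∫ z in D, ⟪∇ b (z - t • w), w⟫_ℝ = 0 := by
    intro t ht
    have htest : IsC1Test B (fun z => b (z + -(t • w))) := by
      refine ⟨hb1.comp (by fun_prop), hbc.comp_homeomorph (Homeomorph.addRight (-(t • w))),
        fun z hz => ?_⟩
      have h1 : z + -(t • w) ∈ tsupport b :=
        tsupport_comp_subset_preimage b (f := fun z => z + -(t • w)) (by fun_prop) hz
      obtain ⟨h2, h3⟩ := hbs h1
      have h4 := hB.add_smul_mem h2.1.1 (show z + -(t • w) + w ∈ B from h3.1.1)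
        (Ioo_subset_Icc_self ht)
      simpa using h4
    have h5 := hweak _ htest
    rw [neg_eq_zero, ← integral_indicator hDo.measurableSet, ← h5]
    congr 1
    ext z
    have h6 := gradient_comp_add_right_apply b (-(t • w)) z
    rw [h6, ← sub_eq_add_neg, zero_mul, add_zero]
    by_cases hz : z ∈ D
    · rw [indicator_of_mem hz, hXdef, indicator_of_mem hz, real_inner_comm]
    · rw [indicator_of_notMem hz, hXdef, indicator_of_notMem hz, inner_zero_left]
  obtain ⟨c, hc, hc'⟩ := exists_hasDerivAt_eq_slope g _ one_pos
    (fun t _ => (hgd t).continuousAt.continuousWithinAt) (fun t _ => hgd t)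
  rw [hder c hc, sub_zero, div_one] at hc'
  have hg0 : 0 < g 0 := by
    have h1 : g 0 = ∫ z, b z := by
      simp only [hg, zero_smul, sub_zero]
      refine setIntegral_eq_integral_of_forall_compl_eq_zero fun z hz => ?_
      by_contra hbz
      exact hz (hbs (subset_tsupport _ hbz)).1
    rw [h1]
    exact hb.continuous.integral_pos_of_hasCompactSupport_nonneg_nonzero hbc hb0
      (x := x) (by rw [hbx]; exact one_ne_zero)
  have hg1 : g 1 = 0 := by
    refine setIntegral_eq_zero_of_forall_eq_zero fun z hz => ?_
    by_contra hbz
    have h1 : z - (1 : ℝ) • w + w ∈ D' := (hbs (subset_tsupport _ hbz)).2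
    rw [one_smul, sub_add_cancel] at h1
    exact Set.disjoint_left.1 hDD hz h1
  linarith

/-- By the convex case every small ball minus `C` lies on one side of a separation. The two families
of such open sets cover `U`, so their unions overlap in a nonempty open set, which the null set `C`
cannot exhaust. -/
theorem IsPreconnected.diff_of_hausdorffMeasure_eq_zero (hd : 1 ≤ Module.finrank ℝ E)
    {U C : Set E} (hU : IsPreconnected U) (hUo : IsOpen U) (hC : IsClosed C)
    (h0 : Measure.hausdorffMeasure ((Module.finrank ℝ E : ℝ) - 1) C = 0) :
    IsPreconnected (U \ C) := by
  rw [isPreconnected_iff_subset_of_disjoint]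
  intro u v hu hv hcov hdis
  by_contra hcon
  rw [not_or, not_subset, not_subset] at hcon
  obtain ⟨⟨x, hxs, hxu⟩, ⟨y, hys, hyv⟩⟩ := hcon
  have hso : IsOpen (U \ C) := hUo.sdiff hC
  have key : ∀ u : Set E, IsOpen (⋃₀ {B | IsOpen B ∧ B \ C ⊆ u}) ∧
      (⋃₀ {B | IsOpen B ∧ B \ C ⊆ u}) \ C ⊆ u := by
    intro u
    refine ⟨isOpen_sUnion fun B hB => hB.1, ?_⟩
    rintro z ⟨⟨B, hB, hzB⟩, hzC⟩
    exact hB.2 ⟨hzB, hzC⟩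
  have hUc : U ⊆ (⋃₀ {B | IsOpen B ∧ B \ C ⊆ u}) ∪ ⋃₀ {B | IsOpen B ∧ B \ C ⊆ v} := by
    intro z hz
    obtain ⟨r, hr, hball⟩ := Metric.isOpen_iff.1 hUo z hz
    have hpre := (convex_ball z r).isPreconnected_diff_of_hausdorffMeasure_eq_zero hd
      Metric.isOpen_ball hC h0
    have hsub : Metric.ball z r \ C ⊆ U \ C := sdiff_subset_sdiff_left hball
    rcases isPreconnected_iff_subset_of_disjoint.1 hpre u v hu hv (hsub.trans hcov)
      (subset_empty_iff.1 (hdis ▸ inter_subset_inter_left _ hsub)) with h | h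
    · exact Or.inl ⟨_, ⟨Metric.isOpen_ball, h⟩, Metric.mem_ball_self hr⟩
    · exact Or.inr ⟨_, ⟨Metric.isOpen_ball, h⟩, Metric.mem_ball_self hr⟩
  obtain ⟨z, hz⟩ := hU _ _ (key u).1 (key v).1 hUc
    ⟨y, hys.1, (U \ C) ∩ u, ⟨hso.inter hu, fun t ht => ht.1.2⟩, hys,
      (hcov hys).resolve_right hyv⟩
    ⟨x, hxs.1, (U \ C) ∩ v, ⟨hso.inter hv, fun t ht => ht.1.2⟩, hxs,
      (hcov hxs).resolve_left hxu⟩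
  obtain ⟨t, ht, htC⟩ := (hUo.inter ((key u).1.inter (key v).1)).nonempty_diff_of_volume_eq_zero
    ⟨z, hz⟩ (volume_eq_zero_of_hausdorffMeasure_eq_zero h0)
  exact notMem_empty t (hdis ▸ ⟨⟨ht.1, htC⟩, (key u).2 ⟨ht.2.1, htC⟩, (key v).2 ⟨ht.2.2, htC⟩⟩)

end Connectedness

/-! ### The two sides of a hypersurface near a point. -/

section Sides

variable {E : Type*} [NormedAddCommGroup E] [InnerProductSpace ℝ E] [CompleteSpace E]

theorem exists_ball_inner_gradient_pos {V : Set E} {ρ : E → ℝ} {e p : E} (hV : IsOpen V)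
    (hρ : ContDiffOn ℝ 1 ρ V) (hp : p ∈ V) (he : 0 < ⟪∇ ρ p, e⟫_ℝ) :
    ∃ r > 0, Metric.ball p r ⊆ V ∧ ∀ x ∈ Metric.ball p r, 0 < ⟪∇ ρ x, e⟫_ℝ := by
  have hcont : ContinuousOn (fun x => ⟪∇ ρ x, e⟫_ℝ) V :=
    (hρ.continuousOn_gradient hV).inner continuousOn_const
  obtain ⟨r, hr, hball⟩ := Metric.eventually_nhds_iff_ball.1
    (((hcont.continuousAt (hV.mem_nhds hp)).eventually_const_lt he).and (hV.eventually_mem hp))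
  exact ⟨r, hr, fun x hx => (hball x hx).2, fun x hx => (hball x hx).1⟩

/-- Two defining functions of one hypersurface that increase in a common direction have the same
negative side. -/
theorem eventually_neg_iff_neg {V₁ V₂ : Set E} {ρ₁ ρ₂ : E → ℝ} {e p : E} (hV₁ : IsOpen V₁)
    (hV₂ : IsOpen V₂) (hρ₁ : ContDiffOn ℝ 1 ρ₁ V₁) (hρ₂ : ContDiffOn ℝ 1 ρ₂ V₂) (hp₁ : p ∈ V₁)
    (hp₂ : p ∈ V₂) (hp0 : ρ₁ p = 0) (hzero : ∀ x ∈ V₁ ∩ V₂, ρ₁ x = 0 → ρ₂ x = 0)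
    (he₁ : 0 < ⟪∇ ρ₁ p, e⟫_ℝ) (he₂ : 0 < ⟪∇ ρ₂ p, e⟫_ℝ) :
    ∀ᶠ x in 𝓝 p, ρ₁ x < 0 ↔ ρ₂ x < 0 := by
  obtain ⟨r₁, hr₁, hb₁, hg₁⟩ := exists_ball_inner_gradient_pos hV₁ hρ₁ hp₁ he₁
  obtain ⟨r₂, hr₂, hb₂, hg₂⟩ := exists_ball_inner_gradient_pos hV₂ hρ₂ hp₂ he₂
  set r := min r₁ r₂ with hr
  have hs₁ : Metric.ball p r ⊆ Metric.ball p r₁ := Metric.ball_subset_ball (min_le_left _ _)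
  have hs₂ : Metric.ball p r ⊆ Metric.ball p r₂ := Metric.ball_subset_ball (min_le_right _ _)
  have hρ₁' := hρ₁.mono (hs₁.trans hb₁)
  have hρ₂' := hρ₂.mono (hs₂.trans hb₂)
  have hg₁' := fun x hx => hg₁ x (hs₁ hx)
  have hg₂' := fun x hx => hg₂ x (hs₂ hx)
  obtain ⟨s, hs0, r', hr', hmem, hup, hdown⟩ := exists_shift_of_inner_gradient_pos
    (lt_min hr₁ hr₂) hρ₁' hg₁' hp0
  filter_upwards [Metric.ball_mem_nhds p hr'] with x hx
  have hcont : ContinuousOn (fun t : ℝ => ρ₁ (x + t • e)) (Icc (-s) s) :=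
    hρ₁'.continuousOn.comp (by fun_prop) fun t ht => hmem x hx t (abs_le.2 ht)
  have h0 : (0 : ℝ) ∈ Icc (ρ₁ (x + (-s) • e)) (ρ₁ (x + s • e)) := by
    refine ⟨?_, (hup x hx).le⟩
    rw [neg_smul, ← sub_eq_add_neg]
    exact (hdown x hx).le
  -- The line through `x` in direction `e` meets the common zero set at `x + t • e`. Both functions
  -- increase along it, so each is negative at `x` exactly when `0 < t`.
  obtain ⟨t, ht, ht1⟩ := intermediate_value_Icc (by linarith) hcont h0
  have htB := hmem x hx t (abs_le.2 ht)
  have hxB : x ∈ Metric.ball p r := by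
    have := hmem x hx 0 (by simpa using hs0.le)
    rwa [zero_smul, add_zero] at this
  have ht2 : ρ₂ (x + t • e) = 0 := hzero _ ⟨hb₁ (hs₁ htB), hb₂ (hs₂ htB)⟩ ht1
  simp only at ht1
  have key : ∀ ρ : E → ℝ, ContDiffOn ℝ 1 ρ (Metric.ball p r) →
      (∀ x ∈ Metric.ball p r, 0 < ⟪∇ ρ x, e⟫_ℝ) → ρ (x + t • e) = 0 → (ρ x < 0 ↔ 0 < t) := by
    intro ρ hρ hg h1
    constructor
    · intro hneg
      by_contra htn
      rcases (not_lt.1 htn).eq_or_lt with h2 | h2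
      · rw [h2, zero_smul, add_zero] at h1
        exact hneg.ne h1
      · have e1 : x + t • e + (-t) • e = x := by simp
        have := lt_of_inner_gradient_pos (convex_ball p r) Metric.isOpen_ball hρ hg
          (neg_pos.2 h2) htB (by rwa [e1])
        rw [e1, h1] at this
        exact absurd hneg this.le.not_gt
    · intro h2
      have := lt_of_inner_gradient_pos (convex_ball p r) Metric.isOpen_ball hρ hg h2 hxB htB
      rwa [h1] at this
  rw [key ρ₁ hρ₁' hg₁' ht1, key ρ₂ hρ₂' hg₂' ht2]

end Sides

/-- Take the component of `{ρ < 0}` in a ball that contains a small ball shifted by `-s • e`. Every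
negative point near `p` descends along `-e` into that shifted ball without leaving `{ρ < 0}`.
Removing `C` keeps this component connected. -/
theorem exists_isPreconnected_side {E : Type*} [NormedAddCommGroup E] [InnerProductSpace ℝ E]
    [FiniteDimensional ℝ E] [MeasurableSpace E] [BorelSpace E]
    (hd : 1 ≤ Module.finrank ℝ E) {V C : Set E} {ρ : E → ℝ} {p : E} (hV : IsOpen V)
    (hρ : ContDiffOn ℝ 1 ρ V) (hp : p ∈ V) (hp0 : ρ p = 0) (hg : ∇ ρ p ≠ 0) (hC : IsClosed C)
    (h0 : Measure.hausdorffMeasure ((Module.finrank ℝ E : ℝ) - 1) C = 0) :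
    ∃ Q, IsPreconnected Q ∧ Q.Nonempty ∧ Q ⊆ {x ∈ V | ρ x < 0} \ C ∧
      ∀ᶠ x in 𝓝 p, ρ x < 0 → x ∉ C → x ∈ Q := by
  obtain ⟨r, hr, hball, hpos⟩ := exists_ball_inner_gradient_pos hV hρ hp (real_inner_self_pos.2 hg)
  set e := ∇ ρ p with he
  have hρB := hρ.mono hball
  obtain ⟨s, hs0, r', hr', hmem, hup, hdown⟩ :=
    exists_shift_of_inner_gradient_pos hr hρB hpos hp0
  set U := Metric.ball p r ∩ {x | ρ x < 0} with hU
  have hUo : IsOpen U := hρB.continuousOn.isOpen_inter_preimage Metric.isOpen_ball isOpen_Iio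
  have hshift : ∀ x ∈ Metric.ball p r', x - s • e ∈ U := by
    intro x hx
    refine ⟨?_, hdown x hx⟩
    have := hmem x hx (-s) (by rw [abs_neg, abs_of_pos hs0])
    rwa [neg_smul, ← sub_eq_add_neg] at this
  have hp' : p ∈ Metric.ball p r' := Metric.mem_ball_self hr'
  have hq := hshift p hp'
  have hsubU : connectedComponentIn U (p - s • e) ⊆ U := connectedComponentIn_subset _ _
  have hpre := (isPreconnected_connectedComponentIn (F := U) (x := p - s • e))
    |>.diff_of_hausdorffMeasure_eq_zero hd hUo.connectedComponentIn hC h0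
  refine ⟨_, hpre, hUo.connectedComponentIn.nonempty_diff_of_volume_eq_zero
    ⟨_, mem_connectedComponentIn hq⟩ (volume_eq_zero_of_hausdorffMeasure_eq_zero h0),
    fun x hx => ⟨⟨hball (hsubU hx.1).1, (hsubU hx.1).2⟩, hx.2⟩, ?_⟩
  filter_upwards [Metric.ball_mem_nhds p hr'] with x hx hx0 hxC
  refine ⟨?_, hxC⟩
  have hxB : x ∈ Metric.ball p r := by
    have := hmem x hx 0 (by simpa using hs0.le)
    rwa [zero_smul, add_zero] at this
  have himg : IsPreconnected ((fun z : E => z - s • e) '' Metric.ball p r') :=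
    (convex_ball p r').isPreconnected.image _ (by fun_prop)
  have h1 : x - s • e ∈ connectedComponentIn U (p - s • e) :=
    himg.subset_connectedComponentIn (mem_image_of_mem _ hp')
      (image_subset_iff.2 hshift) (mem_image_of_mem _ hx)
  have hseg : IsPreconnected ((fun t : ℝ => x - t • e) '' Icc 0 s) :=
    isPreconnected_Icc.image _ (by fun_prop)
  have hsegU : (fun t : ℝ => x - t • e) '' Icc 0 s ⊆ U := by
    rintro _ ⟨t, ht, rfl⟩
    have h2 : x - t • e ∈ Metric.ball p r := by
      have := hmem x hx (-t) (by rw [abs_neg, abs_of_nonneg ht.1]; exact ht.2)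
      rwa [neg_smul, ← sub_eq_add_neg] at this
    refine ⟨h2, ?_⟩
    rcases ht.1.eq_or_lt with h3 | h3
    · simpa [← h3] using hx0
    · have := lt_of_inner_gradient_pos (convex_ball p r) Metric.isOpen_ball hρB hpos h3 h2
        (by simpa using hxB)
      rw [sub_add_cancel] at this
      exact this.trans hx0
  have h4 : x ∈ connectedComponentIn U (x - s • e) :=
    hseg.subset_connectedComponentIn (mem_image_of_mem _ ⟨hs0.le, le_rfl⟩) hsegU
      ⟨0, ⟨le_rfl, hs0.le⟩, by simp⟩
  rwa [connectedComponentIn_eq h1]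

/-! ### Independence of the chosen defining function. -/

section DefiningFunctions

variable {m : ℕ}

theorem norm_unitDir {v : EuclideanSpace ℝ (Fin m)} (hv : v ≠ 0) : ‖unitDir v‖ = 1 := by
  rw [unitDir, norm_smul, norm_inv, norm_norm, inv_mul_cancel₀ (norm_ne_zero_iff.2 hv)]

theorem norm_unitDir_le (v : EuclideanSpace ℝ (Fin m)) : ‖unitDir v‖ ≤ 1 := by
  rcases eq_or_ne v 0 with rfl | hv
  · simp [unitDir]
  · exact (norm_unitDir hv).le

theorem unitDir_neg (v : EuclideanSpace ℝ (Fin m)) : unitDir (-v) = -unitDir v := by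
  simp [unitDir]

theorem inner_eq_norm_mul_inner_unitDir (v w : EuclideanSpace ℝ (Fin m)) :
    ⟪v, w⟫_ℝ = ‖v‖ * ⟪unitDir v, w⟫_ℝ := by
  rcases eq_or_ne v 0 with rfl | hv
  · simp
  · rw [unitDir, real_inner_smul_left, mul_inv_cancel_left₀ (norm_ne_zero_iff.2 hv)]

theorem inner_pos_iff_inner_unitDir_pos {v : EuclideanSpace ℝ (Fin m)} (hv : v ≠ 0)
    (w : EuclideanSpace ℝ (Fin m)) : 0 < ⟪v, w⟫_ℝ ↔ 0 < ⟪unitDir v, w⟫_ℝ := by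
  rw [inner_eq_norm_mul_inner_unitDir]
  exact mul_pos_iff_of_pos_left (norm_pos_iff.2 hv)

namespace IsDefiningFunction

variable {M V V' V₁ V₂ : Set (EuclideanSpace ℝ (Fin m))} {ρ ρ₁ ρ₂ : EuclideanSpace ℝ (Fin m) → ℝ}
  {p : EuclideanSpace ℝ (Fin m)}

theorem mem_iff (h : IsDefiningFunction M V ρ) (hp : p ∈ V) : p ∈ M ↔ ρ p = 0 := by
  have := Set.ext_iff.1 h.inter_eq p
  simpa [hp] using this

theorem mono (h : IsDefiningFunction M V ρ) (hV : IsOpen V') (hVV : V' ⊆ V) :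
    IsDefiningFunction M V' ρ where
  isOpen := hV
  contDiffOn := h.contDiffOn.mono hVV
  grad_ne_zero x hx := h.grad_ne_zero x (hVV hx)
  inter_eq := by
    ext x
    constructor
    · exact fun hx => ⟨hx.2, (h.mem_iff (hVV hx.2)).1 hx.1⟩
    · exact fun hx => ⟨(h.mem_iff (hVV hx.1)).2 hx.2, hx.1⟩

theorem neg (h : IsDefiningFunction M V ρ) : IsDefiningFunction M V (fun x => -ρ x) where
  isOpen := h.isOpen
  contDiffOn := h.contDiffOn.neg
  grad_ne_zero x hx := by
    rw [gradient_neg_apply]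
    exact neg_ne_zero.2 (h.grad_ne_zero x hx)
  inter_eq := by
    rw [h.inter_eq]
    simp

theorem eventually_neg_iff_neg (h₁ : IsDefiningFunction M V₁ ρ₁)
    (h₂ : IsDefiningFunction M V₂ ρ₂) (hp : p ∈ M) (hp₁ : p ∈ V₁) (hp₂ : p ∈ V₂)
    {e : EuclideanSpace ℝ (Fin m)} (he₁ : 0 < ⟪∇ ρ₁ p, e⟫_ℝ) (he₂ : 0 < ⟪∇ ρ₂ p, e⟫_ℝ) :
    ∀ᶠ x in 𝓝 p, ρ₁ x < 0 ↔ ρ₂ x < 0 :=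
  _root_.eventually_neg_iff_neg h₁.isOpen h₂.isOpen h₁.contDiffOn h₂.contDiffOn hp₁ hp₂
    ((h₁.mem_iff hp₁).1 hp) (fun _ hx hx0 => (h₂.mem_iff hx.2).1 ((h₁.mem_iff hx.1).2 hx0)) he₁ he₂

theorem eventually_neg_iff_neg_of_unitDir_eq (h₁ : IsDefiningFunction M V₁ ρ₁)
    (h₂ : IsDefiningFunction M V₂ ρ₂) (hp : p ∈ M) (hp₁ : p ∈ V₁) (hp₂ : p ∈ V₂)
    (h : unitDir (∇ ρ₁ p) = unitDir (∇ ρ₂ p)) : ∀ᶠ x in 𝓝 p, ρ₁ x < 0 ↔ ρ₂ x < 0 := by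
  have h2 := real_inner_self_pos.2 (h₂.grad_ne_zero p hp₂)
  refine h₁.eventually_neg_iff_neg h₂ hp hp₁ hp₂ (e := ∇ ρ₂ p) ?_ h2
  rwa [inner_pos_iff_inner_unitDir_pos (h₁.grad_ne_zero p hp₁), h,
    ← inner_pos_iff_inner_unitDir_pos (h₂.grad_ne_zero p hp₂)]

theorem frequently_neg (h : IsDefiningFunction M V ρ) (hp : p ∈ M) (hpV : p ∈ V) :
    ∃ᶠ x in 𝓝 p, ρ x < 0 := by
  obtain ⟨r, hr, hball, hpos⟩ := exists_ball_inner_gradient_pos h.isOpen h.contDiffOn hpV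
    (real_inner_self_pos.2 (h.grad_ne_zero p hpV))
  refine Metric.nhds_basis_ball.frequently_iff.2 fun r' hr' => ?_
  have hs₁ : Metric.ball p (min r r') ⊆ Metric.ball p r := Metric.ball_subset_ball (min_le_left _ _)
  obtain ⟨s, hs0, r'', hr'', hmem, -, hdown⟩ := exists_shift_of_inner_gradient_pos
    (lt_min hr hr') (h.contDiffOn.mono (hs₁.trans hball)) (fun x hx => hpos x (hs₁ hx))
    ((h.mem_iff hpV).1 hp)
  have hp'' := Metric.mem_ball_self (x := p) hr''
  refine ⟨_, Metric.ball_subset_ball (min_le_right r r') ?_, hdown p hp''⟩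
  have := hmem p hp'' (-s) (by rw [abs_neg, abs_of_pos hs0])
  rwa [neg_smul, ← sub_eq_add_neg] at this

/-- If unit normals `a`, `b` are neither equal nor opposite, `a + b` makes acute angles with `a` and
`b`, and `a - b` with `a` and `-b`. Hence near `p` the negative side of `ρ₁` would be that of both
`ρ₂` and `-ρ₂`, although it has points arbitrarily close to `p`. -/
theorem unitDir_gradient_eq_or_eq_neg (h₁ : IsDefiningFunction M V₁ ρ₁)
    (h₂ : IsDefiningFunction M V₂ ρ₂) (hp : p ∈ M) (hp₁ : p ∈ V₁) (hp₂ : p ∈ V₂) :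
    unitDir (∇ ρ₁ p) = unitDir (∇ ρ₂ p) ∨ unitDir (∇ ρ₁ p) = -unitDir (∇ ρ₂ p) := by
  have g₁ := h₁.grad_ne_zero p hp₁
  have g₂ := h₂.grad_ne_zero p hp₂
  by_contra hcon
  rw [not_or] at hcon
  set a := unitDir (∇ ρ₁ p) with ha
  set b := unitDir (∇ ρ₂ p) with hb
  have haa : ⟪a, a⟫_ℝ = 1 := by rw [real_inner_self_eq_norm_sq, norm_unitDir g₁]; norm_num
  have hbb : ⟪b, b⟫_ℝ = 1 := by rw [real_inner_self_eq_norm_sq, norm_unitDir g₂]; norm_num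
  have hsub : 0 < ⟪a - b, a - b⟫_ℝ := real_inner_self_pos.2 (sub_ne_zero.2 hcon.1)
  have hadd : 0 < ⟪a + b, a + b⟫_ℝ :=
    real_inner_self_pos.2 fun h => hcon.2 (eq_neg_of_add_eq_zero_left h)
  have hba : ⟪b, a⟫_ℝ = ⟪a, b⟫_ℝ := real_inner_comm _ _
  rw [real_inner_sub_sub_self, haa, hbb] at hsub
  rw [real_inner_add_add_self, haa, hbb] at hadd
  have e1 := h₁.eventually_neg_iff_neg h₂ hp hp₁ hp₂ (e := a + b)
    ((inner_pos_iff_inner_unitDir_pos g₁ _).2 (by rw [← ha, inner_add_right, haa]; linarith))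
    ((inner_pos_iff_inner_unitDir_pos g₂ _).2 (by rw [← hb, inner_add_right, hbb, hba]; linarith))
  have e2 := h₁.eventually_neg_iff_neg h₂.neg hp hp₁ hp₂ (e := a - b)
    ((inner_pos_iff_inner_unitDir_pos g₁ _).2 (by rw [← ha, inner_sub_right, haa]; linarith))
    (by
      rw [gradient_neg_apply, inner_neg_left, ← inner_neg_right]
      refine (inner_pos_iff_inner_unitDir_pos g₂ _).2 ?_
      rw [← hb, inner_neg_right, inner_sub_right, hbb, hba]
      linarith)
  obtain ⟨x, hx, hx1, hx2⟩ := ((h₁.frequently_neg hp hp₁).and_eventually (e1.and e2)).exists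
  have := hx1.1 hx
  have := hx2.1 hx
  linarith

theorem volume_inter_eq_zero (h : IsDefiningFunction M V ρ) : volume (M ∩ V) = 0 := by
  rw [h.inter_eq]
  exact volume_zero_set_eq_zero h.isOpen h.contDiffOn h.grad_ne_zero

end IsDefiningFunction

theorem IsC1Hypersurface.volume_eq_zero {M : Set (EuclideanSpace ℝ (Fin m))}
    (h : IsC1Hypersurface M) : volume M = 0 := by
  refine measure_null_of_locally_null _ fun p hp => ?_
  obtain ⟨V, ρ, hpV, hV⟩ := h p hp
  exact ⟨M ∩ V, inter_mem self_mem_nhdsWithin (mem_nhdsWithin_of_mem_nhds (hV.isOpen.mem_nhds hpV)),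
    hV.volume_inter_eq_zero⟩

/-- A one-sided limit in the sense of `HasSideLimit` is a limit along the negative side of any
defining function with the same normal. -/
theorem HasSideLimit.tendsto {Γ A D V : Set (EuclideanSpace ℝ (Fin m))}
    {ρ : EuclideanSpace ℝ (Fin m) → ℝ} {p ν n : EuclideanSpace ℝ (Fin m)}
    {N : EuclideanSpace ℝ (Fin m) → EuclideanSpace ℝ (Fin m)}
    (h : HasSideLimit (Γ \ A) D N p ν n) (hD : IsOutwardNormal Γ A D p ν)
    (hρ : IsDefiningFunction (Γ \ A) V ρ) (hpV : p ∈ V) (hp : p ∈ Γ \ A)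
    (hν : ν = unitDir (∇ ρ p)) : Tendsto N (𝓝[{x | ρ x < 0} \ Γ] p) (𝓝 n) := by
  obtain ⟨V₁, ρ₁, hp₁, h₁, hν₁, ht⟩ := h
  obtain ⟨V₂, ρ₂, hp₂, h₂, hsub, hν₂⟩ := hD
  refine ht.mono_left (nhdsWithin_le_of_mem ?_)
  have e₁ := hρ.eventually_neg_iff_neg_of_unitDir_eq h₁ hp hpV hp₁ (hν ▸ hν₁)
  have e₂ := hρ.eventually_neg_iff_neg_of_unitDir_eq h₂ hp hpV hp₂ (hν ▸ hν₂)
  filter_upwards [self_mem_nhdsWithin, mem_nhdsWithin_of_mem_nhds e₁,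
    mem_nhdsWithin_of_mem_nhds e₂, mem_nhdsWithin_of_mem_nhds (h₁.isOpen.mem_nhds hp₁),
    mem_nhdsWithin_of_mem_nhds (h₂.isOpen.mem_nhds hp₂)] with x hx hx₁ hx₂ hxV₁ hxV₂
  exact ⟨⟨hxV₁, hx₁.1 hx.1⟩, hsub ⟨⟨hxV₂, hx₂.1 hx.1⟩, hx.2⟩⟩

end DefiningFunctions

/-! ### From the variational inequality to a distributional equation. -/

section WeakSolutions

variable {m : ℕ}

theorem IsTestFunction.isC1Test {Ω : Set (EuclideanSpace ℝ (Fin m))}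
    {φ : EuclideanSpace ℝ (Fin m) → ℝ} (h : IsTestFunction Ω φ) : IsC1Test Ω φ :=
  ⟨h.smooth.of_le (by exact_mod_cast le_top), h.compact, h.supp⟩

theorem IsTestFunction.neg {Ω : Set (EuclideanSpace ℝ (Fin m))}
    {φ : EuclideanSpace ℝ (Fin m) → ℝ} (h : IsTestFunction Ω φ) :
    IsTestFunction Ω (fun x => -φ x) :=
  ⟨h.smooth.neg, h.compact.neg, h.isC1Test.neg.supp⟩

/-- Both gradients satisfy the same integration by parts in `U`; the fundamental lemma of the
calculus of variations applies to each component. -/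
theorem IsWeakGradient.ae_eq_gradient {Ω U : Set (EuclideanSpace ℝ (Fin m))}
    {u : EuclideanSpace ℝ (Fin m) → ℝ} {G : EuclideanSpace ℝ (Fin m) → EuclideanSpace ℝ (Fin m)}
    (hG : IsWeakGradient Ω u G) (hU : IsOpen U) (hUΩ : U ⊆ Ω) (hu : ContDiffOn ℝ 1 u U) :
    ∀ᵐ x, x ∈ U → G x = ∇ u x := by
  have hi : ∀ i : Fin m, ∀ᵐ x, x ∈ U → G x i - (∇ u x) i = 0 := by
    intro i
    have hGi : LocallyIntegrableOn (fun x => G x i) U volume :=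
      (EuclideanSpace.proj (𝕜 := ℝ) i).locallyIntegrableOn_comp (hG.locInt.mono_set hUΩ)
    have hui : LocallyIntegrableOn (fun x => (∇ u x) i) U volume :=
      ((EuclideanSpace.proj (𝕜 := ℝ) i).continuous.comp_continuousOn
        (hu.continuousOn_gradient hU)).locallyIntegrableOn hU.measurableSet
    refine hU.ae_eq_zero_of_integral_contDiff_smul_eq_zero (hGi.sub hui) ?_
    intro g hg hgc hgU
    have ht : IsTestFunction Ω g := ⟨hg, hgc, hgU.trans hUΩ⟩
    have hC : IsC1Test U g := ⟨ht.isC1Test.contDiff, hgc, hgU⟩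
    have hby := hG.byParts g ht i
    rw [setIntegral_eq_integral_of_forall_compl_eq_zero fun x hx => by
        rw [ht.isC1Test.gradient_eq_zero hx]; simp,
      setIntegral_eq_integral_of_forall_compl_eq_zero fun x hx => by
        rw [ht.isC1Test.eq_zero hx]; simp] at hby
    have hcl := hasWeakDivergence_smul_const hU hu (EuclideanSpace.single i 1) g hC
    have hu0 : LocallyIntegrableOn (fun x => u x • EuclideanSpace.single i (1 : ℝ)) U volume :=
      (hu.continuousOn.smul continuousOn_const).locallyIntegrableOn hU.measurableSet
    have hz : LocallyIntegrableOn (fun _ : EuclideanSpace ℝ (Fin m) => (0 : ℝ)) U volume :=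
      locallyIntegrableOn_zero
    have hz' : LocallyIntegrableOn (fun _ : EuclideanSpace ℝ (Fin m) =>
        (0 : EuclideanSpace ℝ (Fin m))) U volume := locallyIntegrableOn_zero
    have i1 : Integrable (fun x => u x * (∇ g x) i) := by
      have := hC.integrable hu0 hz
      refine this.congr (.of_forall fun x => ?_)
      simp only [real_inner_smul_left, zero_mul, add_zero]
      rw [real_inner_comm, EuclideanSpace.inner_single_right]
      simp
    have i2 : Integrable (fun x => (∇ u x) i * g x) := by
      have := hC.integrable hz' hui
      refine this.congr (.of_forall fun x => ?_)
      simp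
    have i3 : Integrable (fun x => G x i * g x) := by
      have := hC.integrable hz' hGi
      refine this.congr (.of_forall fun x => ?_)
      simp
    have hcl' : (∫ x, u x * (∇ g x) i) + ∫ x, (∇ u x) i * g x = 0 := by
      rw [← integral_add i1 i2, ← hcl]
      congr 1
      ext x
      beta_reduce
      rw [real_inner_smul_left, real_inner_comm, EuclideanSpace.inner_single_right,
        EuclideanSpace.inner_single_right]
      simp
    have hfin : ∫ x, g x • (G x i - (∇ u x) i) = (∫ x, G x i * g x) - ∫ x, (∇ u x) i * g x := by
      rw [← integral_sub i3 i2]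
      congr 1
      ext x
      simp only [smul_eq_mul]
      ring
    exact hfin.trans (by linarith)
  filter_upwards [ae_all_iff.2 hi] with x hx hxU
  ext i
  exact sub_eq_zero.1 (hx i hxU)

/-- If `u` has no singular points off a null set, a weak solution is a distributional one. -/
theorem isWeakSolution_iff_forall_integral_eq_zero {Ω Γ : Set (EuclideanSpace ℝ (Fin m))}
    {F : EuclideanSpace ℝ (Fin m) → EuclideanSpace ℝ (Fin m)}
    {H u : EuclideanSpace ℝ (Fin m) → ℝ} (hΩ : MeasurableSet Ω) (hU : IsOpen (Ω \ Γ))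
    (hΓ : volume Γ = 0)
    (hHi : LocallyIntegrableOn H Ω volume) (hW : MemW1 Ω u) (hu : ContDiffOn ℝ 1 u (Ω \ Γ))
    (hS : ∀ x ∈ Ω \ Γ, ∇ u x + F x ≠ 0)
    (hN : LocallyIntegrableOn (normalField F u) Ω volume) :
    IsWeakSolution Ω F H u ↔ ∀ φ, IsTestFunction Ω φ →
      ∫ x, (⟪normalField F u x, ∇ φ x⟫_ℝ + H x * φ x) = 0 := by
  have hΓae : ∀ᵐ x, x ∉ Γ := measure_eq_zero_iff_ae_notMem.1 hΓ
  -- This holds for every weak gradient `G`, so the choice of `G` in `IsWeakSolution` is immaterial.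
  have key : ∀ G, IsWeakGradient Ω u G → ∀ φ, IsTestFunction Ω φ →
      (∫ x in {x ∈ Ω | G x + F x = 0}, ‖∇ φ x‖)
        + (∫ x in {x ∈ Ω | G x + F x ≠ 0}, ⟪unitDir (G x + F x), ∇ φ x⟫_ℝ)
        + ∫ x in Ω, H x * φ x = ∫ x, (⟪normalField F u x, ∇ φ x⟫_ℝ + H x * φ x) := by
    intro G hG φ hφ
    have hGu : ∀ᵐ x, x ∈ Ω → G x = ∇ u x ∧ ∇ u x + F x ≠ 0 := by
      filter_upwards [hG.ae_eq_gradient hU sdiff_subset hu, hΓae] with x hx hxΓ hxΩ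
      exact ⟨hx ⟨hxΩ, hxΓ⟩, hS x ⟨hxΩ, hxΓ⟩⟩
    have hS0 : volume {x ∈ Ω | G x + F x = 0} = 0 := by
      rw [measure_eq_zero_iff_ae_notMem]
      filter_upwards [hGu] with x hx hx'
      obtain ⟨h1, h2⟩ := hx hx'.1
      exact h2 (h1 ▸ hx'.2)
    have hS1 : ({x ∈ Ω | G x + F x ≠ 0} : Set _) =ᵐ[volume] Ω := by
      filter_upwards [hGu] with x hx
      refine propext ⟨fun h => h.1, fun h => ⟨h, ?_⟩⟩
      obtain ⟨h1, h2⟩ := hx h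
      rwa [h1]
    have hC := hφ.isC1Test
    have i1 : Integrable (fun x => ⟪normalField F u x, ∇ φ x⟫_ℝ) := by
      have := hC.integrable (h := fun _ => 0) hN locallyIntegrableOn_zero
      simpa only [zero_mul, add_zero] using this
    have i2 : Integrable (fun x => H x * φ x) := by
      have := hC.integrable (X := fun _ => 0) locallyIntegrableOn_zero hHi
      simpa only [inner_zero_left, zero_add] using this
    rw [setIntegral_measure_zero _ hS0, zero_add, setIntegral_congr_set hS1, integral_add i1 i2,
      setIntegral_eq_integral_of_forall_compl_eq_zero (f := fun x => H x * φ x) fun x hx => by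
        rw [hC.eq_zero hx, mul_zero],
      ← setIntegral_eq_integral_of_forall_compl_eq_zero (s := Ω)
        (f := fun x => ⟪normalField F u x, ∇ φ x⟫_ℝ) fun x hx => by
        rw [hC.gradient_eq_zero hx, inner_zero_right]]
    congr 1
    refine setIntegral_congr_ae hΩ ?_
    filter_upwards [hGu] with x hx hxΩ
    rw [(hx hxΩ).1, normalField]
  constructor
  · rintro ⟨-, G, hG, hsol⟩ φ hφ
    have h1 := hsol φ hφ
    have h2 := hsol _ hφ.neg
    rw [key G hG _ hφ] at h1
    rw [key G hG _ hφ.neg] at h2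
    refine le_antisymm ?_ h1
    rw [← neg_nonneg, ← integral_neg]
    refine h2.trans_eq ?_
    congr 1
    ext x
    rw [gradient_neg_apply, inner_neg_right]
    ring
  · intro h
    obtain ⟨hu1, G, hG⟩ := hW
    exact ⟨hu1, G, hG, fun φ hφ => by rw [key G hG φ hφ, h φ hφ]⟩

end WeakSolutions

/-! ### A jump of the normal component is incompatible with the equation. -/

section Jumps

variable {E : Type*} [NormedAddCommGroup E] [InnerProductSpace ℝ E] [FiniteDimensional ℝ E]
  [MeasurableSpace E] [BorelSpace E]

theorem HasWeakDivergence.normal_limit_le {V Γ : Set E} {ρ : E → ℝ} {X : E → E} {h : E → ℝ} {p : E}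
    {α β : ℝ} (hV : IsOpen V) (hρ : ContDiffOn ℝ 1 ρ V) (hp : p ∈ V) (hp0 : ρ p = 0)
    (hg : ∇ ρ p ≠ 0) (hΓ : volume Γ = 0) (hX : HasWeakDivergence (V ∩ {x | ρ x ≠ 0}) X h)
    (hXi : LocallyIntegrableOn X V volume) (hhi : LocallyIntegrableOn h V volume)
    (hzero : ∀ φ, ContDiff ℝ ∞ φ → IsC1Test V φ → ∫ x, (⟪X x, ∇ φ x⟫_ℝ + h x * φ x) = 0)
    (hα : Tendsto (fun x => ⟪X x, ∇ ρ x⟫_ℝ) (𝓝[{x | ρ x < 0} \ Γ] p) (𝓝 α))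
    (hβ : Tendsto (fun x => ⟪X x, ∇ ρ x⟫_ℝ) (𝓝[{x | 0 < ρ x} \ Γ] p) (𝓝 β)) : β ≤ α := by
  by_contra hlt
  rw [not_le] at hlt
  set e := ∇ ρ p with he
  have hc : 0 < ⟪∇ ρ p, e⟫_ℝ := real_inner_self_pos.2 hg
  set c := ⟪∇ ρ p, e⟫_ℝ with hcdef
  -- After multiplication by `c`, `a` is the midpoint of `α` and `β` and `δ` a quarter of their gap,
  -- so `(a ± δ) c` lie strictly between them.
  set a := (α + β) / (2 * c) with ha
  set δ := (β - α) / (4 * c) with hδ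
  have hδ0 : 0 < δ := div_pos (by linarith) (by positivity)
  have hup : (a + δ) * c < β := by
    have : (a + δ) * c = (α + β) / 2 + (β - α) / 4 := by rw [ha, hδ]; field_simp
    linarith
  have hdn : α < (a - δ) * c := by
    have : (a - δ) * c = (α + β) / 2 - (β - α) / 4 := by rw [ha, hδ]; field_simp
    linarith
  have hgc : Tendsto (fun x => ⟪∇ ρ x, e⟫_ℝ) (𝓝 p) (𝓝 c) :=
    ((hρ.continuousOn_gradient hV).inner continuousOn_const).continuousAt (hV.mem_nhds hp)
  have e1 := ((hgc.const_mul (a + δ)).mono_left nhdsWithin_le_nhds).eventually_lt hβ hup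
  have e2 := hα.eventually_lt ((hgc.const_mul (a - δ)).mono_left nhdsWithin_le_nhds) hdn
  obtain ⟨r, hr, hball⟩ := Metric.eventually_nhds_iff_ball.1
    ((hgc.eventually_const_lt hc).and ((hV.eventually_mem hp).and
      ((eventually_nhdsWithin_iff.1 e1).and (eventually_nhdsWithin_iff.1 e2))))
  have hsub : Metric.ball p r ⊆ V := fun x hx => (hball x hx).2.1
  have hΓae : ∀ᵐ x, x ∉ Γ := measure_eq_zero_iff_ae_notMem.1 hΓ
  obtain ⟨φ, hφ, hφt, hneg⟩ := exists_test_integral_neg_of_jump (e := e) (a := a) Metric.isOpen_ball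
    (hρ.mono hsub) (fun x hx => (hball x hx).1)
    (hX.mono (inter_subset_inter_left _ hsub)) (hXi.mono_set hsub) (hhi.mono_set hsub)
    (Metric.mem_ball_self hr) hp0 hδ0
    (by
      filter_upwards [hΓae] with x hxΓ hx hx0
      exact ((hball x hx).2.2.1 ⟨hx0, hxΓ⟩).le)
    (by
      filter_upwards [hΓae] with x hxΓ hx hx0
      exact ((hball x hx).2.2.2 ⟨hx0, hxΓ⟩).le)
  exact hneg.ne (hzero φ hφ (hφt.mono hsub))

theorem HasWeakDivergence.normal_limit_eq {V Γ : Set E} {ρ : E → ℝ} {X : E → E} {h : E → ℝ} {p : E}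
    {α β : ℝ} (hV : IsOpen V) (hρ : ContDiffOn ℝ 1 ρ V) (hp : p ∈ V) (hp0 : ρ p = 0)
    (hg : ∇ ρ p ≠ 0) (hΓ : volume Γ = 0) (hX : HasWeakDivergence (V ∩ {x | ρ x ≠ 0}) X h)
    (hXi : LocallyIntegrableOn X V volume) (hhi : LocallyIntegrableOn h V volume)
    (hzero : ∀ φ, ContDiff ℝ ∞ φ → IsC1Test V φ → ∫ x, (⟪X x, ∇ φ x⟫_ℝ + h x * φ x) = 0)
    (hα : Tendsto (fun x => ⟪X x, ∇ ρ x⟫_ℝ) (𝓝[{x | ρ x < 0} \ Γ] p) (𝓝 α))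
    (hβ : Tendsto (fun x => ⟪X x, ∇ ρ x⟫_ℝ) (𝓝[{x | 0 < ρ x} \ Γ] p) (𝓝 β)) : α = β := by
  refine le_antisymm ?_ (hX.normal_limit_le hV hρ hp hp0 hg hΓ hXi hhi hzero hα hβ)
  refine neg_le_neg_iff.1 (hX.neg.normal_limit_le hV hρ hp hp0 hg hΓ hXi.neg hhi.neg ?_
    (by simpa only [inner_neg_left] using hα.neg) (by simpa only [inner_neg_left] using hβ.neg))
  intro φ hφ hφt
  rw [← neg_eq_zero, ← integral_neg, ← hzero φ hφ hφt]
  congr 1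
  ext x
  rw [inner_neg_left]
  ring

end Jumps

/-! ### Components adjacent to the hypersurface. -/

section Hypersurfaces

variable {m : ℕ} {Ω Γ A : Set (EuclideanSpace ℝ (Fin m))}

/-- Inside `V`, points of `Γ` off `{ρ = 0}` belong to `A`, and they may accumulate at `p`. The
negative side minus `closure A` is nevertheless connected near `p` and avoids `Γ`, so a single
component contains it. -/
theorem exists_component_isOutwardNormal (hm : 1 ≤ m) (hΓΩ : Γ ⊆ Ω)
    (hΩ : IsOpen Ω) (hAU : Ω \ Γ ⊆ Ω \ closure A)
    (hA : Measure.hausdorffMeasure ((m : ℝ) - 1) (closure A) = 0)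
    {V : Set (EuclideanSpace ℝ (Fin m))} {ρ : EuclideanSpace ℝ (Fin m) → ℝ}
    {p : EuclideanSpace ℝ (Fin m)} (hρ : IsDefiningFunction (Γ \ A) V ρ) (hpV : p ∈ V)
    (hp : p ∈ Γ \ A) :
    ∃ D, IsComponentOf (Ω \ Γ) D ∧ IsOutwardNormal Γ A D p (unitDir (∇ ρ p)) := by
  have hρ' := hρ.mono (hρ.isOpen.inter hΩ) inter_subset_left
  have hpV' : p ∈ V ∩ Ω := ⟨hpV, hΓΩ hp.1⟩
  obtain ⟨Q, hQ, ⟨q, hq⟩, hQs, hQe⟩ := exists_isPreconnected_side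
    (by simpa using hm) hρ'.isOpen hρ'.contDiffOn hpV'
    ((hρ.mem_iff hpV).1 hp) (hρ.grad_ne_zero p hpV) isClosed_closure (by simpa using hA)
  have hQU : Q ⊆ Ω \ Γ := by
    intro x hx
    obtain ⟨⟨⟨hxV, hxΩ⟩, hx0⟩, hxA⟩ := hQs hx
    refine ⟨hxΩ, fun hxΓ => hx0.ne ((hρ.mem_iff hxV).1 ⟨hxΓ, fun h => hxA (subset_closure h)⟩)⟩
  obtain ⟨r, hr, hball⟩ := Metric.eventually_nhds_iff_ball.1
    (hQe.and (hρ'.isOpen.mem_nhds hpV'))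
  refine ⟨_, ⟨q, hQU hq, rfl⟩, Metric.ball p r, ρ, Metric.mem_ball_self hr,
    hρ.mono Metric.isOpen_ball fun x hx => (hball x hx).2.1, ?_, rfl⟩
  rintro x ⟨⟨hxb, hx0⟩, hxΓ⟩
  obtain ⟨h1, h2⟩ := hball x hxb
  refine hQ.subset_connectedComponentIn hq hQU (h1 hx0 ?_)
  exact (hAU ⟨h2.2, hxΓ⟩).2

end Hypersurfaces

/-! ### The equivalence. -/

theorem theorem6p3 (m : ℕ) (hm : 1 ≤ m)
    (Ω Γ A : Set (EuclideanSpace ℝ (Fin m)))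
    (F : EuclideanSpace ℝ (Fin m) → EuclideanSpace ℝ (Fin m))
    (H u : EuclideanSpace ℝ (Fin m) → ℝ)
    -- `Ω` is a bounded domain
    (hΩo : IsOpen Ω) (hΩc : IsConnected Ω) (hΩb : Bornology.IsBounded Ω)
    -- `A ⊆ Γ ⊆ Ω`, `Γ` relatively closed, `Γ \ A` a `C¹` hypersurface, `H^{m-1}(Ā) = 0`
    (hAΓ : A ⊆ Γ) (hΓΩ : Γ ⊆ Ω) (hΓ : ∃ C, IsClosed C ∧ Γ = Ω ∩ C)
    (hM : IsC1Hypersurface (Γ \ A))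
    (hA : Measure.hausdorffMeasure ((m : ℝ) - 1) (closure A) = 0)
    -- the data of the equation
    (hF : ContDiffOn ℝ 1 F (Ω \ Γ))
    (hHc : ContinuousOn H (Ω \ Γ)) (hHi : LocallyIntegrableOn H Ω volume)
    -- `u ∈ W¹(Ω) ∩ C¹(Ω \ Γ)` has no singular points in `Ω \ Γ`
    (hW : MemW1 Ω u) (hu : ContDiffOn ℝ 1 u (Ω \ Γ))
    (hS : ∀ x ∈ Ω \ Γ, ∇ u x + F x ≠ 0)
    -- on each component, `N(u)` is `C¹` and `div N(u) = H`
    (hN : ∀ D, IsComponentOf (Ω \ Γ) D →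
      ContDiffOn ℝ 1 (normalField F u) D ∧ ∀ x ∈ D, divergence (normalField F u) x = H x)
    -- and `N(u)` extends continuously to `Γ \ A`, from each side
    (hT : ∀ D, IsComponentOf (Ω \ Γ) D → ∀ p ∈ Γ \ A, ∀ ν, IsOutwardNormal Γ A D p ν →
      ∃ n, HasSideLimit (Γ \ A) D (normalField F u) p ν n) :
    IsWeakSolution Ω F H u ↔
      ∀ p ∈ Γ \ A, ∃ Dj Dl νj νl Nj Nl,
        IsComponentOf (Ω \ Γ) Dj ∧ IsComponentOf (Ω \ Γ) Dl ∧
        IsOutwardNormal Γ A Dj p νj ∧ IsOutwardNormal Γ A Dl p νl ∧ νl = -νj ∧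
        HasSideLimit (Γ \ A) Dj (normalField F u) p νj Nj ∧
        HasSideLimit (Γ \ A) Dl (normalField F u) p νl Nl ∧
        ⟪Nj - Nl, νj⟫_ℝ = 0 ∧ ⟪Nj - Nl, νl⟫_ℝ = 0 := by
  have hd : 1 ≤ Module.finrank ℝ (EuclideanSpace ℝ (Fin m)) := by simpa using hm
  have hA' : Measure.hausdorffMeasure ((Module.finrank ℝ (EuclideanSpace ℝ (Fin m)) : ℝ) - 1)
      (closure A) = 0 := by simpa using hA
  have hU : IsOpen (Ω \ Γ) := by
    obtain ⟨C, hC, rfl⟩ := hΓ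
    rw [sdiff_self_inter]
    exact hΩo.sdiff hC
  have hAU : Ω \ Γ ⊆ Ω \ closure A := by
    refine fun x hx => ⟨hx.1, fun hxA => ?_⟩
    obtain ⟨y, hy, hyA⟩ := mem_closure_iff.1 hxA _ hU hx
    exact hy.2 (hAΓ hyA)
  have hA0 : volume (closure A) = 0 := volume_eq_zero_of_hausdorffMeasure_eq_zero hA'
  have hΓ0 : volume Γ = 0 := by
    refine measure_mono_null (fun x hx => ?_)
      (measure_union_null hA0 hM.volume_eq_zero)
    by_cases hxA : x ∈ A
    · exact Or.inl (subset_closure hxA)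
    · exact Or.inr ⟨hx, hxA⟩
  have hΓae : ∀ᵐ x, x ∉ Γ := measure_eq_zero_iff_ae_notMem.1 hΓ0
  set N := normalField F u with hNdef
  have hcomp : ∀ x ∈ Ω \ Γ, ContDiffAt ℝ 1 N x ∧ divergence N x = H x := by
    intro x hx
    obtain ⟨h1, h2⟩ := hN _ ⟨x, hx, rfl⟩
    have hxD := mem_connectedComponentIn hx
    exact ⟨h1.contDiffAt (hU.connectedComponentIn.mem_nhds hxD), h2 x hxD⟩
  have hNc : ContDiffOn ℝ 1 N (Ω \ Γ) := fun x hx => (hcomp x hx).1.contDiffWithinAt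
  have hNU : HasWeakDivergence (Ω \ Γ) N H :=
    hasWeakDivergence_of_contDiffOn hU hNc fun x hx => (hcomp x hx).2
  have hN1 : ∀ x, ‖N x‖ ≤ 1 := fun x => norm_unitDir_le _
  -- `N` is bounded by `1`, `Ω` has finite measure, and `N` is continuous off the null set `Γ`.
  have hNi : LocallyIntegrableOn N Ω volume := by
    have hae : (Ω \ Γ : Set _) =ᵐ[volume] Ω := sdiff_null_ae_eq_self hΓ0
    have h1 : AEStronglyMeasurable N (volume.restrict Ω) := by
      rw [← Measure.restrict_congr_set hae]
      exact hNc.continuousOn.aestronglyMeasurable hU.measurableSet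
    exact (IntegrableOn.of_bound hΩb.measure_lt_top h1 1
      (.of_forall hN1)).locallyIntegrableOn
  rw [isWeakSolution_iff_forall_integral_eq_zero hΩo.measurableSet hU hΓ0 hHi hW hu hS hNi,
    ← hNdef]
  constructor
  · intro hsol p hp
    obtain ⟨V, ρ, hpV, hρ⟩ := hM p hp
    have hρn := hρ.neg
    have hνn : unitDir (∇ (fun x => -ρ x) p) = -unitDir (∇ ρ p) := by
      rw [gradient_neg_apply, unitDir_neg]
    obtain ⟨Dj, hDj, hνj⟩ := exists_component_isOutwardNormal hm hΓΩ hΩo hAU hA hρ hpV hp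
    obtain ⟨Dl, hDl, hνl⟩ := exists_component_isOutwardNormal hm hΓΩ hΩo hAU hA hρn hpV hp
    obtain ⟨Nj, hNj⟩ := hT Dj hDj p hp _ hνj
    obtain ⟨Nl, hNl⟩ := hT Dl hDl p hp _ hνl
    have tj := hNj.tendsto hνj hρ hpV hp rfl
    have tl := hNl.tendsto hνl hρn hpV hp rfl
    simp only [neg_lt_zero] at tl
    have hρ' := hρ.mono (hρ.isOpen.inter hΩo) inter_subset_left
    have hpV' : p ∈ V ∩ Ω := ⟨hpV, hΓΩ hp.1⟩
    have hgc : Tendsto (∇ ρ) (𝓝 p) (𝓝 (∇ ρ p)) :=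
      (hρ.contDiffOn.continuousOn_gradient hρ.isOpen).continuousAt (hρ.isOpen.mem_nhds hpV)
    -- The point `p` may lie in `closure A`, so the equation on the two sides is itself obtained by
    -- removability.
    have hwd : HasWeakDivergence ((V ∩ Ω) ∩ {x | ρ x ≠ 0}) N H := by
      refine HasWeakDivergence.of_diff hd (B := 1) isClosed_closure hA' (hNU.mono ?_)
        (hNi.mono_set fun x hx => hx.1.2) (hHi.mono_set fun x hx => hx.1.2) hN1
      rintro x ⟨⟨⟨hxV, hxΩ⟩, hx0⟩, hxA⟩
      exact ⟨hxΩ, fun hxΓ => hx0 ((hρ.mem_iff hxV).1 ⟨hxΓ, fun h => hxA (subset_closure h)⟩)⟩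
    have heq : ⟪Nj, ∇ ρ p⟫_ℝ = ⟪Nl, ∇ ρ p⟫_ℝ :=
      hwd.normal_limit_eq hρ'.isOpen hρ'.contDiffOn hpV' ((hρ.mem_iff hpV).1 hp)
        (hρ.grad_ne_zero p hpV) hΓ0 (hNi.mono_set inter_subset_right)
        (hHi.mono_set inter_subset_right)
        (fun φ hφ hφt => hsol φ ⟨hφ, hφt.compact, hφt.supp.trans inter_subset_right⟩)
        (tj.inner (hgc.mono_left nhdsWithin_le_nhds))
        (tl.inner (hgc.mono_left nhdsWithin_le_nhds))
    have h0 : ⟪Nj - Nl, unitDir (∇ ρ p)⟫_ℝ = 0 := by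
      rw [unitDir, real_inner_smul_right, inner_sub_left, heq, sub_self, mul_zero]
    refine ⟨Dj, Dl, _, _, Nj, Nl, hDj, hDl, hνj, hνl, hνn, hNj, hNl, h0, ?_⟩
    rw [hνn, inner_neg_right, h0, neg_zero]
  · intro hjump
    suffices h : HasWeakDivergence Ω N H from fun φ hφ => h φ hφ.isC1Test
    refine HasWeakDivergence.of_diff hd (B := 1) isClosed_closure hA' ?_ hNi hHi hN1
    refine HasWeakDivergence.of_locally (hNi.mono_set sdiff_subset) (hHi.mono_set sdiff_subset) ?_
    rintro x ⟨hxΩ, hxA⟩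
    by_cases hxΓ : x ∈ Γ
    swap
    · exact ⟨Ω \ Γ, hU, ⟨hxΩ, hxΓ⟩, hAU, hNU⟩
    obtain ⟨V, ρ, hxV, hρ⟩ := hM x ⟨hxΓ, fun h => hxA (subset_closure h)⟩
    -- Here `closure A` has already been removed, so near `x` the set `Γ` is exactly the zero set of
    -- `ρ`.
    have hWo : IsOpen (V ∩ (Ω \ closure A)) := hρ.isOpen.inter (hΩo.sdiff isClosed_closure)
    obtain ⟨r, hr, hball, hpos⟩ := exists_ball_inner_gradient_pos hWo
      (hρ.contDiffOn.mono inter_subset_left) (⟨hxV, hxΩ, hxA⟩ : x ∈ V ∩ (Ω \ closure A))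
      (real_inner_self_pos.2 (hρ.grad_ne_zero x hxV))
    have hρB := hρ.mono Metric.isOpen_ball (hball.trans inter_subset_left)
    have hBΩ : Metric.ball x r ⊆ Ω := fun y hy => (hball hy).2.1
    have hoff : Metric.ball x r ∩ {y | ρ y ≠ 0} ⊆ Ω \ Γ := fun y hy =>
      ⟨hBΩ hy.1, fun hyΓ => hy.2 ((hρB.mem_iff hy.1).1
        ⟨hyΓ, fun h => (hball hy.1).2.2 (subset_closure h)⟩)⟩
    refine ⟨Metric.ball x r, Metric.isOpen_ball, Metric.mem_ball_self hr,
      hball.trans inter_subset_right, ?_⟩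
    refine HasWeakDivergence.of_normal_limits Metric.isOpen_ball hρB.contDiffOn hpos
      (hNU.mono hoff) (hNi.mono_set hBΩ) (hHi.mono_set hBΩ) fun p hp => ?_
    have hgc : Tendsto (∇ ρ) (𝓝 p) (𝓝 (∇ ρ p)) :=
      (hρB.contDiffOn.continuousOn_gradient hρB.isOpen).continuousAt (hρB.isOpen.mem_nhds hp)
    by_cases hp0 : ρ p = 0
    swap
    · exact ⟨_, ((hcomp p (hoff ⟨hp, hp0⟩)).1.continuousAt.tendsto.inner hgc).mono_left
        nhdsWithin_le_nhds⟩
    have hpM : p ∈ Γ \ A := (hρB.mem_iff hp).2 hp0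
    obtain ⟨Dj, Dl, νj, νl, Nj, Nl, -, -, hνj, hνl, hνν, hNj, hNl, h0, -⟩ := hjump p hpM
    -- The given normals come from other defining functions; they match `ρ` up to a sign, which only
    -- decides which component plays the negative side.
    have hνρ : νj = unitDir (∇ ρ p) ∨ νj = -unitDir (∇ ρ p) := by
      obtain ⟨V₁, ρ₁, hp₁, h₁, -, h₂⟩ := hνj
      rw [h₂]
      exact h₁.unitDir_gradient_eq_or_eq_neg hρB hpM hp₁ hp
    have hνn : unitDir (∇ (fun x => -ρ x) p) = -unitDir (∇ ρ p) := by
      rw [gradient_neg_apply, unitDir_neg]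
    have hsides : Metric.ball x r ∩ {y | ρ y ≠ 0} ⊆ {y | ρ y < 0} \ Γ ∪ {y | -ρ y < 0} \ Γ := by
      intro y hy
      have hyΓ := (hoff hy).2
      rcases lt_or_gt_of_ne hy.2 with h | h
      · exact Or.inl ⟨h, hyΓ⟩
      · exact Or.inr ⟨neg_lt_zero.2 h, hyΓ⟩
    have hin : ⟪Nj, νj⟫_ℝ = ⟪Nl, νj⟫_ℝ := by rwa [inner_sub_left, sub_eq_zero] at h0
    have hglue : ∀ a b : EuclideanSpace ℝ (Fin m), ⟪a, ∇ ρ p⟫_ℝ = ⟪b, ∇ ρ p⟫_ℝ →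
        Tendsto N (𝓝[{y | ρ y < 0} \ Γ] p) (𝓝 a) → Tendsto N (𝓝[{y | -ρ y < 0} \ Γ] p) (𝓝 b) →
        ∃ L, Tendsto (fun y => ⟪N y, ∇ ρ y⟫_ℝ) (𝓝[Metric.ball x r ∩ {y | ρ y ≠ 0}] p) (𝓝 L) := by
      intro a b hab ha hb
      refine ⟨⟪a, ∇ ρ p⟫_ℝ, Tendsto.mono_left ?_ (nhdsWithin_mono p hsides)⟩
      rw [nhdsWithin_union]
      refine Tendsto.sup (ha.inner (hgc.mono_left nhdsWithin_le_nhds)) ?_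
      rw [hab]
      exact hb.inner (hgc.mono_left nhdsWithin_le_nhds)
    have hnorm : ∀ a : EuclideanSpace ℝ (Fin m),
        ⟪a, ∇ ρ p⟫_ℝ = ‖∇ ρ p‖ * ⟪a, unitDir (∇ ρ p)⟫_ℝ := fun a => by
      rw [real_inner_comm, inner_eq_norm_mul_inner_unitDir, real_inner_comm]
    rcases hνρ with h | h
    · refine hglue Nj Nl ?_ (hNj.tendsto hνj hρB hp hpM h)
        (hNl.tendsto hνl hρB.neg hp hpM (by rw [hνν, h, hνn]))
      rw [hnorm, hnorm, ← h, hin]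
    · refine hglue Nl Nj ?_ (hNl.tendsto hνl hρB hp hpM (by rw [hνν, h, neg_neg]))
        (hNj.tendsto hνj hρB.neg hp hpM (by rw [h, hνn]))
      have h' : unitDir (∇ ρ p) = -νj := by rw [h, neg_neg]
      rw [hnorm, hnorm, h', inner_neg_right, inner_neg_right, hin]
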